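/- Let $N\ge 1$, let $\Omega\subseteq\mathbb{R}^N$ be open and bounded, and let $\sigma(x)=\mathrm{dist}(x,\partial\Omega)$. Let $\rho\in C_c^\infty(\mathbb{R}^N)$ satisfy $0\le\rho\le 1$, $\rho(x)=0\iff |x|\ge 1$, be radially symmetric, and satisfy $\rho(x)\ge\rho(y)$ whenever $|x|<1/2=|y|$. Let $\eta\in C^\infty(\Omega)$ satisfy $\eta\le\sigma$ on $\Omega$ and the quadratic condition: for some $\kappa>0$, $$\kappa\,\sigma(x)^2\le\eta(x)\le\sigma(x)^2\qquad\text{for all }x\in\Omega .$$ For $f\in L^1(\Omega)$, $x\in\Omega$ and $n\ge 1$ put $$Tf(x)=M_\rho\int_{B_1(0)}\rho(z)f(x-\eta(x)z)\,dz,\qquad T_nf(x)=M_\rho\int_{B_1(0)}\rho(z)f\Big(x-\frac{\eta(x)}{n}z\Big)\,dz,\qquad M_\rho=\Big(\int_{B_1(0)}\rho\Big)^{-1}.$$ Then: 1. For every $f\in L^1(\Omega)$, $T_nf\in L^1(\Omega)$ for all $n\ge 1$, and $T_nf\to f$ in $L^1(\Omega)$ as $n\to\infty$. 2. If $\nabla\eta$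 is bounded on $\Omega$, then $T$ is a bounded linear operator from $W^{1,1}(\Omega)$ to itself; and for every $f\in W^{1,1}(\Omega)$, $T_nf\in W^{1,1}(\Omega)$ for all $n\ge 1$ and $T_nf\to f$ in $W^{1,1}(\Omega)$ as $n\to\infty$. 3. The gradient condition in 2 holds whenever $\eta=c\,(T_\theta\sigma)^2$ on $\Omega$, where $c\in\mathbb{R}$, $\theta\in C^\infty(\mathbb{R}^N)$ is non-negative, vanishes exactly on $\partial\Omega$ together with all its derivatives, and satisfies $\theta(x)<\mathrm{dist}(x,\partial\Omega)$ for $x\notin\partial\Omega$, and $T_\theta$ denotes the operator $T$ with $\theta$ in place of $\eta$. Here $W^{1,1}(\Omega)$ carries the norm $\|f\|_{L^1(\Omega)}+\|\nabla f\|_{L^1(\Omega)}$, with $\nabla f$ the weak gradient. -/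

import Mathlib

open MeasureTheory Set Filter Topology
open scoped ContDiff

noncomputable section

/-- The Euclidean space `ℝᴺ`. -/
abbrev EucSp (N : ℕ) : Type := EuclideanSpace ℝ (Fin N)

/-- `σ(x) = dist(x, ∂Ω)`, the distance to the boundary of `Ω`. -/
def bdryDist {N : ℕ} (Ω : Set (EucSp N)) (x : EucSp N) : ℝ :=
  Metric.infDist x (frontier Ω)

/-- The mollifying kernels `ρ`: smooth, `0 ≤ ρ ≤ 1`, vanishing exactly outside the open unit ball,
radially symmetric, and with `ρ(x) ≥ ρ(1/2)` for `|x| < 1/2`. -/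
structure IsMollifierKernel {N : ℕ} (ρ : EucSp N → ℝ) : Prop where
  smooth : ContDiff ℝ ∞ ρ
  nonneg : ∀ x, 0 ≤ ρ x
  le_one : ∀ x, ρ x ≤ 1
  eq_zero_iff : ∀ x, ρ x = 0 ↔ 1 ≤ ‖x‖
  radial : ∀ x y, ‖x‖ = ‖y‖ → ρ x = ρ y
  half_le : ∀ x y, ‖x‖ < 1 / 2 → ‖y‖ = 1 / 2 → ρ y ≤ ρ x

/-- The variable step mollifier
`T f (x) = M_ρ ∫_{B_1(0)} ρ(z) f(x - η(x) z) dz`, with `M_ρ = (∫_{B_1(0)} ρ)⁻¹`. -/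
def varMollify {N : ℕ} (ρ η f : EucSp N → ℝ) (x : EucSp N) : ℝ :=
  (∫ z in Metric.ball (0 : EucSp N) 1, ρ z)⁻¹ *
    ∫ z in Metric.ball (0 : EucSp N) 1, ρ z * f (x - η x • z)

/-- The operators `T_n`: the variable step mollifier with `η` replaced by `η / n`. -/
def varMollifySeq {N : ℕ} (ρ η : EucSp N → ℝ) (n : ℕ) (f : EucSp N → ℝ) : EucSp N → ℝ :=
  varMollify ρ (fun x => η x / n) f

/-- The quadratic condition: `κ σ(x)² ≤ η(x) ≤ σ(x)²` on `Ω`, for some `κ > 0`. -/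
def QuadraticStep {N : ℕ} (Ω : Set (EucSp N)) (η : EucSp N → ℝ) : Prop :=
  ∃ κ : ℝ, 0 < κ ∧ ∀ x ∈ Ω, κ * bdryDist Ω x ^ 2 ≤ η x ∧ η x ≤ bdryDist Ω x ^ 2

/-- `∇η` is bounded on `Ω` (used for `η` smooth on the open set `Ω`). -/
def BoundedGradientOn {N : ℕ} (Ω : Set (EucSp N)) (η : EucSp N → ℝ) : Prop :=
  ∃ L : ℝ, ∀ x ∈ Ω, ‖fderiv ℝ η x‖ ≤ L

/-- `θ` is a smooth non-negative function on `ℝᴺ` that vanishes exactly on `Θ`, together with all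
its derivatives, and stays below the distance to `Θ` off `Θ`. -/
structure IsWhitneyFunction {N : ℕ} (Θ : Set (EucSp N)) (θ : EucSp N → ℝ) : Prop where
  smooth : ContDiff ℝ ∞ θ
  nonneg : ∀ x, 0 ≤ θ x
  eq_zero_iff : ∀ x, θ x = 0 ↔ x ∈ Θ
  flat : ∀ x ∈ Θ, ∀ k : ℕ, iteratedFDeriv ℝ k θ x = 0
  lt_dist : ∀ x, x ∉ Θ → θ x < Metric.infDist x Θ

/-- `φ ∈ C_c^∞(Ω)`. -/
structure IsTestFn {N : ℕ} (Ω : Set (EucSp N)) (φ : EucSp N → ℝ) : Prop where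
  smooth : ContDiff ℝ ∞ φ
  compact : HasCompactSupport φ
  support : tsupport φ ⊆ Ω

/-- `g ∈ L¹(Ω; ℝᴺ)` is the weak gradient of `f ∈ L¹(Ω)`:
`∫_Ω f ∂_v φ = - ∫_Ω φ ⟨g, v⟩` for all test functions `φ` and all directions `v`. -/
def HasWeakGradient {N : ℕ} (Ω : Set (EucSp N)) (f : Lp ℝ 1 (volume.restrict Ω))
    (g : Lp (EucSp N) 1 (volume.restrict Ω)) : Prop :=
  ∀ φ : EucSp N → ℝ, IsTestFn Ω φ → ∀ v : EucSp N,
    ∫ x in Ω, fderiv ℝ φ x v * f x = - ∫ x in Ω, φ x * inner ℝ v (g x)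

theorem IsTestFn.integrable_mul {N : ℕ} {Ω : Set (EucSp N)} {φ : EucSp N → ℝ}
    (hφ : IsTestFn Ω φ) {h : EucSp N → ℝ} (hh : Integrable h (volume.restrict Ω)) :
    Integrable (fun x => φ x * h x) (volume.restrict Ω) := by
  obtain ⟨C, hC⟩ := hφ.compact.exists_bound_of_continuous hφ.smooth.continuous
  exact hh.bdd_mul hφ.smooth.continuous.aestronglyMeasurable (Eventually.of_forall hC)

theorem IsTestFn.integrable_fderiv_mul {N : ℕ} {Ω : Set (EucSp N)} {φ : EucSp N → ℝ}
    (hφ : IsTestFn Ω φ) (v : EucSp N) {h : EucSp N → ℝ}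
    (hh : Integrable h (volume.restrict Ω)) :
    Integrable (fun x => fderiv ℝ φ x v * h x) (volume.restrict Ω) := by
  have hc : Continuous (fun x => fderiv ℝ φ x v) :=
    (hφ.smooth.continuous_fderiv (by simp)).clm_apply continuous_const
  have hs : HasCompactSupport (fun x => fderiv ℝ φ x v) := hφ.compact.fderiv_apply (𝕜 := ℝ) v
  obtain ⟨C, hC⟩ := hs.exists_bound_of_continuous hc
  exact hh.bdd_mul hc.aestronglyMeasurable (Eventually.of_forall hC)

theorem Lp_one_integrable {N : ℕ} {Ω : Set (EucSp N)} {F : Type*} [NormedAddCommGroup F]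
    (f : Lp F 1 (volume.restrict Ω)) : Integrable f (volume.restrict Ω) :=
  memLp_one_iff_integrable.1 (Lp.memLp f)

/-- The Sobolev space `W^{1,1}(Ω)`, as the space of pairs `(f, ∇f)` with `f ∈ L¹(Ω)` and weak
gradient `∇f ∈ L¹(Ω; ℝᴺ)`; its norm is `‖f‖_{L¹} + ‖∇f‖_{L¹}`. The second component is determined
by the first. -/
def W11 {N : ℕ} (Ω : Set (EucSp N)) :
    Submodule ℝ (WithLp 1 (Lp ℝ 1 (volume.restrict Ω) × Lp (EucSp N) 1 (volume.restrict Ω))) where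
  carrier := {p | HasWeakGradient Ω p.fst p.snd}
  zero_mem' := by
    intro φ _ v
    have h1 : ∫ x in Ω, fderiv ℝ φ x v * (0 : Lp ℝ 1 (volume.restrict Ω)) x = 0 := by
      apply integral_eq_zero_of_ae
      filter_upwards [Lp.coeFn_zero ℝ 1 (volume.restrict Ω)] with x hx
      rw [hx]
      simp
    have h2 : ∫ x in Ω, φ x * inner ℝ v ((0 : Lp (EucSp N) 1 (volume.restrict Ω)) x) = 0 := by
      apply integral_eq_zero_of_ae
      filter_upwards [Lp.coeFn_zero (EucSp N) 1 (volume.restrict Ω)] with x hx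
      rw [hx]
      simp
    simp only [WithLp.zero_fst, WithLp.zero_snd]
    rw [h1, h2, neg_zero]
  add_mem' := by
    intro p q hp hq φ hφ v
    have h1 : ∫ x in Ω, fderiv ℝ φ x v * (p.fst + q.fst) x
        = (∫ x in Ω, fderiv ℝ φ x v * p.fst x) + ∫ x in Ω, fderiv ℝ φ x v * q.fst x := by
      rw [← integral_add (hφ.integrable_fderiv_mul v (Lp_one_integrable _))
        (hφ.integrable_fderiv_mul v (Lp_one_integrable _))]
      apply integral_congr_ae
      filter_upwards [Lp.coeFn_add p.fst q.fst] with x hx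
      rw [hx, Pi.add_apply, mul_add]
    have h2 : ∫ x in Ω, φ x * inner ℝ v ((p.snd + q.snd) x)
        = (∫ x in Ω, φ x * inner ℝ v (p.snd x)) + ∫ x in Ω, φ x * inner ℝ v (q.snd x) := by
      rw [← integral_add (hφ.integrable_mul ((Lp_one_integrable _).const_inner v))
        (hφ.integrable_mul ((Lp_one_integrable _).const_inner v))]
      apply integral_congr_ae
      filter_upwards [Lp.coeFn_add p.snd q.snd] with x hx
      rw [hx, Pi.add_apply, inner_add_right, mul_add]
    simp only [WithLp.add_fst, WithLp.add_snd]
    rw [h1, h2, hp φ hφ v, hq φ hφ v]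
    ring
  smul_mem' := by
    intro c p hp φ hφ v
    have h1 : ∫ x in Ω, fderiv ℝ φ x v * (c • p.fst) x
        = c * ∫ x in Ω, fderiv ℝ φ x v * p.fst x := by
      rw [← integral_const_mul]
      apply integral_congr_ae
      filter_upwards [Lp.coeFn_smul c p.fst] with x hx
      rw [hx, Pi.smul_apply, smul_eq_mul]
      ring
    have h2 : ∫ x in Ω, φ x * inner ℝ v ((c • p.snd) x)
        = c * ∫ x in Ω, φ x * inner ℝ v (p.snd x) := by
      rw [← integral_const_mul]
      apply integral_congr_ae
      filter_upwards [Lp.coeFn_smul c p.snd] with x hx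
      rw [hx, Pi.smul_apply, inner_smul_right]
      ring
    simp only [WithLp.smul_fst, WithLp.smul_snd]
    rw [h1, h2, hp φ hφ v]
    ring

/-- `f` is a representative, on `Ω`, of the element `u` of `W^{1,1}(Ω)`. -/
def IsRepr {N : ℕ} {Ω : Set (EucSp N)} (f : EucSp N → ℝ) (u : W11 Ω) : Prop :=
  f =ᵐ[volume.restrict Ω] u.1.fst

end

/-! Write `Φ_s(x, z) = x - s η(x) z` on `Ω × B_1(0)`, so that `T` is the case `s = 1`, `T_n` the
case `s = 1/n`, and `s = 0` the identity. Everything rests on one estimate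
(`exists_map_stepMap_le`): `Φ_s` pushes Lebesgue measure on `Ω × B_1(0)` to a measure at most `C`
times Lebesgue measure on `Ω`, with `C` independent of `s ∈ [0, 1]`. No change of variables in `x`
is made, hence no bound on `∇η` is needed. By Tonelli it suffices to bound, uniformly in `y`, the
integral over `x` of `(s η(x))⁻ᴺ 1{|x - y| < s η(x)}`. Since `σ` is 1-Lipschitz and `η` is
comparable to `σ²`, this kernel is dominated by normalised indicators of balls centred at `y`, whose
radii depend on `y` only.

The estimate makes every average of `h ∘ Φ_s` against a bounded weight a bounded operator on `L¹`.
It also gives strong continuity in `s`: approximate `h` by bounded continuous functions, with an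
error uniform in `s` (`tendsto_fiberAverage`). Letting `s = 1/n → 0` yields the first claim.

For the second, the chain rule predicts `∇(T_s f)(x) = M_ρ ∫ ρ(z) (∇f(Φ_s) - s ⟨z, ∇f(Φ_s)⟩ ∇η(x))
dz`, again such an average when `∇η` is bounded. This is checked weakly for `C¹` functions by Fubini
and integration by parts. For `s < 1`, Sobolev functions are reached by ordinary mollification,
because `Φ_s` keeps compact subsets of `Ω` away from the boundary; `s = 1` follows by continuity in
`s`.

For the third, `T_θ σ` is bounded and Lipschitz on `Ω`, hence so is its square. -/

open scoped ENNReal NNReal in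
/-- The weighted fibre average `x ↦ ∫ W(x, z) (h (Φ(x, z))) dν(z)` of a function `h`. -/
noncomputable def fiberAverage {X Z Y E F : Type*} [MeasurableSpace Z]
    [NormedAddCommGroup E] [NormedSpace ℝ E] [NormedAddCommGroup F] [NormedSpace ℝ F]
    (ν : Measure Z) (W : X × Z → E →L[ℝ] F) (Φ : X × Z → Y) (h : Y → E) (x : X) : F :=
  ∫ z, W (x, z) (h (Φ (x, z))) ∂ν

open scoped ENNReal NNReal in
/-- `Φ` transports `μ ⊗ ν` to a measure dominated by `C • l`, and the weight `W` is bounded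
by `b`. -/
structure IsFiberKernel {X Z Y E F : Type*} [MeasurableSpace X] [MeasurableSpace Z]
    [MeasurableSpace Y]
    [NormedAddCommGroup E] [NormedSpace ℝ E] [NormedAddCommGroup F] [NormedSpace ℝ F]
    (μ : Measure X) (ν : Measure Z) (l : Measure Y)
    (W : X × Z → E →L[ℝ] F) (Φ : X × Z → Y) (b C : ℝ≥0) : Prop where
  aemeasurable : AEMeasurable Φ (μ.prod ν)
  map_le : Measure.map Φ (μ.prod ν) ≤ (C : ℝ≥0∞) • l
  aestronglyMeasurable : AEStronglyMeasurable W (μ.prod ν)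
  bound : ∀ᵐ p ∂(μ.prod ν), ‖W p‖ₑ ≤ b

/-! ### Composition with maps whose pushforward measure is dominated. -/

section TransportedFunctions

open scoped ENNReal NNReal

variable {P Y E : Type*} [MeasurableSpace P] [MeasurableSpace Y] [NormedAddCommGroup E]
  {m : Measure P} {l : Measure Y} {C : ℝ≥0}

theorem ae_comp_of_map_le {Φ : P → Y} (hΦ : AEMeasurable Φ m)
    (hle : Measure.map Φ m ≤ (C : ℝ≥0∞) • l) {p : Y → Prop} (hp : ∀ᵐ y ∂l, p y) :
    ∀ᵐ x ∂m, p (Φ x) := by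
  have hac : Measure.map Φ m ≪ l :=
    (Measure.absolutelyContinuous_of_le hle).trans Measure.smul_absolutelyContinuous
  exact ae_of_ae_map hΦ (hac.ae_le hp)

theorem integrable_comp_of_map_le {Φ : P → Y} (hΦ : AEMeasurable Φ m)
    (hle : Measure.map Φ m ≤ (C : ℝ≥0∞) • l) {h : Y → E} (hh : Integrable h l) :
    Integrable (fun x => h (Φ x)) m :=
  ((hh.smul_measure ENNReal.coe_ne_top).mono_measure hle).comp_aemeasurable hΦ

theorem lintegral_comp_le_of_map_le {Φ : P → Y} (hΦ : AEMeasurable Φ m)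
    (hle : Measure.map Φ m ≤ (C : ℝ≥0∞) • l) {h : Y → E} (hh : AEStronglyMeasurable h l) :
    ∫⁻ x, ‖h (Φ x)‖ₑ ∂m ≤ C * ∫⁻ y, ‖h y‖ₑ ∂l := by
  have hac : Measure.map Φ m ≪ l :=
    (Measure.absolutelyContinuous_of_le hle).trans Measure.smul_absolutelyContinuous
  calc ∫⁻ x, ‖h (Φ x)‖ₑ ∂m = ∫⁻ y, ‖h y‖ₑ ∂(Measure.map Φ m) :=
        (lintegral_map' (hh.mono_ac hac).enorm hΦ).symm
    _ ≤ ∫⁻ y, ‖h y‖ₑ ∂((C : ℝ≥0∞) • l) := lintegral_mono' hle le_rfl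
    _ = C * ∫⁻ y, ‖h y‖ₑ ∂l := by rw [lintegral_smul_measure]; rfl

/-- For bounded continuous `h` this is dominated convergence on a finite measure space. The general
case follows by density in `L¹`: the common constant `C` controls the approximation error after
composition, uniformly in `n`. -/
theorem tendsto_lintegral_comp_sub [IsFiniteMeasure m] [TopologicalSpace Y] [NormalSpace Y]
    [BorelSpace Y] [l.WeaklyRegular] [NormedSpace ℝ E] {Φ : ℕ → P → Y} {Φ₀ : P → Y}
    (hΦ : ∀ n, AEMeasurable (Φ n) m) (hle : ∀ n, Measure.map (Φ n) m ≤ (C : ℝ≥0∞) • l)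
    (hΦ₀ : AEMeasurable Φ₀ m) (hle₀ : Measure.map Φ₀ m ≤ (C : ℝ≥0∞) • l)
    (hlim : ∀ᵐ x ∂m, Tendsto (fun n => Φ n x) atTop (𝓝 (Φ₀ x)))
    {h : Y → E} (hh : Integrable h l) :
    Tendsto (fun n => ∫⁻ x, ‖h (Φ n x) - h (Φ₀ x)‖ₑ ∂m) atTop (𝓝 0) := by
  rw [ENNReal.tendsto_nhds_zero]
  intro ε hε
  obtain ⟨δ, hδ0, hδ⟩ : ∃ δ : ℝ≥0∞, δ ≠ 0 ∧ C * δ ≤ ε / 3 := by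
    have hε3 : ε / 3 ≠ 0 := (ENNReal.div_pos hε.ne' (by simp)).ne'
    -- The `+ 1` avoids dividing by zero when `C = 0`.
    refine ⟨ε / 3 / (C + 1), (ENNReal.div_pos hε3 (by simp)).ne', ?_⟩
    calc (C : ℝ≥0∞) * (ε / 3 / (C + 1)) ≤ (C + 1) * (ε / 3 / (C + 1)) := by
          gcongr; exact le_self_add
      _ ≤ ε / 3 := ENNReal.mul_div_le
  obtain ⟨g, hg, hgi⟩ := hh.exists_boundedContinuous_lintegral_sub_le hδ0
  have hsub : AEStronglyMeasurable (fun y => h y - g y) l :=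
    hh.aestronglyMeasurable.sub hgi.aestronglyMeasurable
  have hg0 : Tendsto (fun n => ∫⁻ x, ‖g (Φ n x) - g (Φ₀ x)‖ₑ ∂m) atTop (𝓝 0) := by
    have hgm : ∀ {Ψ : P → Y}, AEMeasurable Ψ m → Measure.map Ψ m ≤ (C : ℝ≥0∞) • l →
        AEStronglyMeasurable (fun x => g (Ψ x)) m := fun hΨ hl =>
      (integrable_comp_of_map_le hΨ hl hgi).aestronglyMeasurable
    have := tendsto_lintegral_of_dominated_convergence' (μ := m)
      (F := fun n x => ‖g (Φ n x) - g (Φ₀ x)‖ₑ) (f := fun _ => 0)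
      (fun _ => ENNReal.ofReal (2 * ‖g‖))
      (fun n => ((hgm (hΦ n) (hle n)).sub (hgm hΦ₀ hle₀)).enorm)
      (fun n => Eventually.of_forall fun x => by
        change ‖g (Φ n x) - g (Φ₀ x)‖ₑ ≤ ENNReal.ofReal (2 * ‖g‖)
        rw [← ofReal_norm]
        exact ENNReal.ofReal_le_ofReal (by
          rw [← dist_eq_norm]; exact g.dist_le_two_norm _ _))
      (by
        rw [lintegral_const]
        exact ENNReal.mul_ne_top ENNReal.ofReal_ne_top (measure_ne_top m univ))
      (by
        filter_upwards [hlim] with x hx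
        have h1 : Tendsto (fun n => g (Φ n x) - g (Φ₀ x)) atTop (𝓝 (g (Φ₀ x) - g (Φ₀ x))) :=
          ((g.continuous.tendsto _).comp hx).sub_const _
        simpa using h1.enorm)
    simpa using this
  rw [ENNReal.tendsto_nhds_zero] at hg0
  filter_upwards [hg0 (ε / 3) (ENNReal.div_pos hε.ne' (by simp))] with n hn
  have hi : ∀ {Ψ : P → Y}, AEMeasurable Ψ m → Measure.map Ψ m ≤ (C : ℝ≥0∞) • l →
      AEMeasurable (fun x => ‖h (Ψ x) - g (Ψ x)‖ₑ) m := fun hΨ hl =>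
    ((integrable_comp_of_map_le hΨ hl hh).sub
      (integrable_comp_of_map_le hΨ hl hgi)).aestronglyMeasurable.enorm
  calc ∫⁻ x, ‖h (Φ n x) - h (Φ₀ x)‖ₑ ∂m
      ≤ ∫⁻ x, (‖h (Φ n x) - g (Φ n x)‖ₑ + ‖g (Φ n x) - g (Φ₀ x)‖ₑ)
          + ‖h (Φ₀ x) - g (Φ₀ x)‖ₑ ∂m := by
        refine lintegral_mono fun x => ?_
        rw [← enorm_neg (h (Φ₀ x) - g (Φ₀ x))]
        refine le_trans (le_of_eq ?_) ((enorm_add_le _ _).trans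
          (add_le_add_left (enorm_add_le _ _) _))
        congr 1; abel
    _ = (∫⁻ x, ‖h (Φ n x) - g (Φ n x)‖ₑ ∂m + ∫⁻ x, ‖g (Φ n x) - g (Φ₀ x)‖ₑ ∂m)
          + ∫⁻ x, ‖h (Φ₀ x) - g (Φ₀ x)‖ₑ ∂m := by
        rw [lintegral_add_right' _ (hi hΦ₀ hle₀), lintegral_add_left' (hi (hΦ n) (hle n))]
    _ ≤ (ε / 3 + ε / 3) + ε / 3 := by
        gcongr
        · exact (lintegral_comp_le_of_map_le (hΦ n) (hle n) hsub).trans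
            ((by gcongr : _ ≤ (C : ℝ≥0∞) * δ).trans hδ)
        · exact (lintegral_comp_le_of_map_le hΦ₀ hle₀ hsub).trans
            ((by gcongr : _ ≤ (C : ℝ≥0∞) * δ).trans hδ)
    _ = ε := ENNReal.add_thirds ε

end TransportedFunctions

/-! ### Weighted fibre averages as bounded operators on `L¹`. -/

section FiberAverage

open scoped ENNReal NNReal

variable {X Z Y E F : Type*} [MeasurableSpace X] [MeasurableSpace Z] [MeasurableSpace Y]
  [NormedAddCommGroup E] [NormedSpace ℝ E] [NormedAddCommGroup F] [NormedSpace ℝ F]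
  {μ : Measure X} {ν : Measure Z} {l : Measure Y}
  {W : X × Z → E →L[ℝ] F} {Φ : X × Z → Y} {b C : ℝ≥0}

theorem lintegral_clm_apply_le {P : Type*} [MeasurableSpace P] {m : Measure P}
    {W : P → E →L[ℝ] F} {b : ℝ≥0∞} (hW : ∀ᵐ p ∂m, ‖W p‖ₑ ≤ b) {H : P → E}
    (hH : AEStronglyMeasurable H m) :
    ∫⁻ p, ‖W p (H p)‖ₑ ∂m ≤ b * ∫⁻ p, ‖H p‖ₑ ∂m := by
  rw [← lintegral_const_mul'' _ hH.enorm]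
  refine lintegral_mono_ae ?_
  filter_upwards [hW] with p hp
  exact ((W p).le_opENorm _).trans (by gcongr)

theorem integrable_clm_apply {P : Type*} [MeasurableSpace P] {m : Measure P}
    {W : P → E →L[ℝ] F} (hm : AEStronglyMeasurable W m) {b : ℝ≥0}
    (hW : ∀ᵐ p ∂m, ‖W p‖ₑ ≤ b) {H : P → E} (hH : Integrable H m) :
    Integrable (fun p => W p (H p)) m := by
  refine ⟨isBoundedBilinearMap_apply.continuous.comp_aestronglyMeasurable
    (hm.prodMk hH.aestronglyMeasurable), ?_⟩
  exact (lintegral_clm_apply_le hW hH.aestronglyMeasurable).trans_lt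
    (ENNReal.mul_lt_top ENNReal.coe_lt_top hH.2)

theorem fiberAverage_smul {X Z Y E F : Type*} [MeasurableSpace Z]
    [NormedAddCommGroup E] [NormedSpace ℝ E] [NormedAddCommGroup F] [NormedSpace ℝ F]
    {ν : Measure Z} {W : X × Z → E →L[ℝ] F} {Φ : X × Z → Y} (c : ℝ) (h : Y → E) :
    fiberAverage ν W Φ (c • h) = c • fiberAverage ν W Φ h := by
  ext x
  simp only [fiberAverage, Pi.smul_apply, map_smul]
  exact integral_smul c _

namespace IsFiberKernel

variable (hk : IsFiberKernel μ ν l W Φ b C)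
include hk

theorem integrable_integrand {h : Y → E} (hh : Integrable h l) :
    Integrable (fun p => W p (h (Φ p))) (μ.prod ν) :=
  integrable_clm_apply hk.aestronglyMeasurable hk.bound
    (integrable_comp_of_map_le hk.aemeasurable hk.map_le hh)

variable [SFinite ν]

/-- Null sets pull back to null sets under `Φ`, and almost every slice of a null set is null; so the
average is well defined on classes of functions. -/
theorem fiberAverage_congr {h h' : Y → E} (hh : h =ᵐ[l] h') :
    fiberAverage ν W Φ h =ᵐ[μ] fiberAverage ν W Φ h' := by
  have h1 := ae_comp_of_map_le hk.aemeasurable hk.map_le hh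
  filter_upwards [Measure.ae_ae_of_ae_prod h1] with x hx
  refine integral_congr_ae ?_
  filter_upwards [hx] with z hz
  rw [hz]

theorem integrable_fiberAverage {h : Y → E} (hh : Integrable h l) :
    Integrable (fiberAverage ν W Φ h) μ :=
  (hk.integrable_integrand hh).integral_prod_left

theorem lintegral_fiberAverage_le {h : Y → E} (hh : Integrable h l) :
    ∫⁻ x, ‖fiberAverage ν W Φ h x‖ₑ ∂μ ≤ b * C * ∫⁻ y, ‖h y‖ₑ ∂l := by
  have hi := integrable_comp_of_map_le hk.aemeasurable hk.map_le hh
  calc ∫⁻ x, ‖fiberAverage ν W Φ h x‖ₑ ∂μ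
      ≤ ∫⁻ x, ∫⁻ z, ‖W (x, z) (h (Φ (x, z)))‖ₑ ∂ν ∂μ :=
        lintegral_mono fun x => enorm_integral_le_lintegral_enorm _
    _ = ∫⁻ p, ‖W p (h (Φ p))‖ₑ ∂(μ.prod ν) :=
        (lintegral_prod _ (hk.integrable_integrand hh).aestronglyMeasurable.enorm).symm
    _ ≤ b * ∫⁻ p, ‖h (Φ p)‖ₑ ∂(μ.prod ν) :=
        lintegral_clm_apply_le hk.bound hi.aestronglyMeasurable
    _ ≤ b * (C * ∫⁻ y, ‖h y‖ₑ ∂l) := by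
        gcongr
        exact lintegral_comp_le_of_map_le hk.aemeasurable hk.map_le hh.aestronglyMeasurable
    _ = b * C * ∫⁻ y, ‖h y‖ₑ ∂l := (mul_assoc _ _ _).symm

variable [SFinite μ]

theorem fiberAverage_add {h h' : Y → E} (hh : Integrable h l) (hh' : Integrable h' l) :
    fiberAverage ν W Φ (h + h') =ᵐ[μ] fiberAverage ν W Φ h + fiberAverage ν W Φ h' := by
  filter_upwards [(hk.integrable_integrand hh).prod_right_ae,
    (hk.integrable_integrand hh').prod_right_ae] with x hx hx'
  simp only [fiberAverage, Pi.add_apply, map_add]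
  exact integral_add hx hx'

/-- The fibre average as a bounded operator between `L¹` spaces. -/
noncomputable def toCLM : Lp E 1 l →L[ℝ] Lp F 1 μ :=
  LinearMap.mkContinuous
    { toFun := fun h => (hk.integrable_fiberAverage (L1.integrable_coeFn h)).toL1 _
      map_add' := fun h h' => by
        rw [← Integrable.toL1_add]
        refine Integrable.toL1_eq_toL1_iff _ _ _ _ |>.2 ?_
        exact (hk.fiberAverage_congr (Lp.coeFn_add h h')).trans
          (hk.fiberAverage_add (L1.integrable_coeFn h) (L1.integrable_coeFn h'))
      map_smul' := fun c h => by
        rw [RingHom.id_apply, ← Integrable.toL1_smul]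
        refine Integrable.toL1_eq_toL1_iff _ _ _ _ |>.2 ?_
        exact (hk.fiberAverage_congr (Lp.coeFn_smul c h)).trans
          (Eventually.of_forall fun x => congrFun (fiberAverage_smul c h) x) }
    (b * C) (fun h => by
      change ‖(hk.integrable_fiberAverage (L1.integrable_coeFn h)).toL1 _‖ ≤ _
      rw [Integrable.norm_toL1, L1.norm_def, ← NNReal.coe_mul,
        ← ENNReal.coe_toReal (b * C), ← ENNReal.toReal_mul]
      refine ENNReal.toReal_mono (ENNReal.mul_ne_top ENNReal.coe_ne_top ?_) ?_
      · exact (L1.integrable_coeFn h).2.ne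
      · simpa [edist_zero_right] using hk.lintegral_fiberAverage_le (L1.integrable_coeFn h))

theorem coeFn_toCLM (h : Lp E 1 l) : hk.toCLM h =ᵐ[μ] fiberAverage ν W Φ h :=
  Integrable.coeFn_toL1 (hk.integrable_fiberAverage (L1.integrable_coeFn h))

end IsFiberKernel

/-- Split `W_n h(Φ_n) - W₀ h(Φ₀)` as `(W_n - W₀) h(Φ_n) + W₀ (h(Φ_n) - h(Φ₀))`. The first term is
small because the weights converge uniformly, the second by `tendsto_lintegral_comp_sub`. -/
theorem tendsto_fiberAverage [IsFiniteMeasure μ] [IsFiniteMeasure ν] [TopologicalSpace Y]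
    [NormalSpace Y] [BorelSpace Y] [l.WeaklyRegular]
    {W : ℕ → X × Z → E →L[ℝ] F} {Φ : ℕ → X × Z → Y} {W₀ : X × Z → E →L[ℝ] F} {Φ₀ : X × Z → Y}
    (hk : ∀ n, IsFiberKernel μ ν l (W n) (Φ n) b C) (hk₀ : IsFiberKernel μ ν l W₀ Φ₀ b C)
    (hΦ : ∀ᵐ p ∂(μ.prod ν), Tendsto (fun n => Φ n p) atTop (𝓝 (Φ₀ p)))
    {a : ℕ → ℝ≥0∞} (ha : Tendsto a atTop (𝓝 0))
    (hW : ∀ n, ∀ᵐ p ∂(μ.prod ν), ‖W n p - W₀ p‖ₑ ≤ a n) {h : Y → E} (hh : Integrable h l) :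
    Tendsto (fun n => eLpNorm (fiberAverage ν (W n) (Φ n) h - fiberAverage ν W₀ Φ₀ h) 1 μ)
      atTop (𝓝 0) := by
  have hlim := tendsto_lintegral_comp_sub (fun n => (hk n).aemeasurable) (fun n => (hk n).map_le)
    hk₀.aemeasurable hk₀.map_le hΦ hh
  have hfin : C * ∫⁻ y, ‖h y‖ₑ ∂l ≠ ⊤ := (ENNReal.mul_lt_top ENNReal.coe_lt_top hh.2).ne
  have hup : Tendsto (fun n => a n * (C * ∫⁻ y, ‖h y‖ₑ ∂l)
      + b * ∫⁻ p, ‖h (Φ n p) - h (Φ₀ p)‖ₑ ∂(μ.prod ν)) atTop (𝓝 0) := by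
    have h1 := ENNReal.Tendsto.mul_const ha (b := C * ∫⁻ y, ‖h y‖ₑ ∂l) (Or.inr hfin)
    have h2 := ENNReal.Tendsto.const_mul hlim (a := (b : ℝ≥0∞)) (Or.inr ENNReal.coe_ne_top)
    simpa using h1.add h2
  refine tendsto_of_tendsto_of_tendsto_of_le_of_le tendsto_const_nhds hup
    (fun _ => zero_le) fun n => ?_
  have hn := integrable_comp_of_map_le (hk n).aemeasurable (hk n).map_le hh
  have h0 := integrable_comp_of_map_le hk₀.aemeasurable hk₀.map_le hh
  have hWm := (hk n).aestronglyMeasurable.sub hk₀.aestronglyMeasurable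
  have hIn := (hk n).integrable_integrand hh
  have hI0 := hk₀.integrable_integrand hh
  rw [eLpNorm_one_eq_lintegral_enorm]
  calc ∫⁻ x, ‖(fiberAverage ν (W n) (Φ n) h - fiberAverage ν W₀ Φ₀ h) x‖ₑ ∂μ
      ≤ ∫⁻ x, ∫⁻ z, ‖W n (x, z) (h (Φ n (x, z))) - W₀ (x, z) (h (Φ₀ (x, z)))‖ₑ ∂ν ∂μ := by
        refine lintegral_mono_ae ?_
        filter_upwards [hIn.prod_right_ae, hI0.prod_right_ae] with x h1 h2
        rw [Pi.sub_apply, fiberAverage, fiberAverage, ← integral_sub h1 h2]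
        exact enorm_integral_le_lintegral_enorm _
    _ = ∫⁻ p, ‖W n p (h (Φ n p)) - W₀ p (h (Φ₀ p))‖ₑ ∂(μ.prod ν) :=
        (lintegral_prod _ (hIn.sub hI0).aestronglyMeasurable.enorm).symm
    _ ≤ ∫⁻ p, ‖(W n p - W₀ p) (h (Φ n p))‖ₑ + ‖W₀ p (h (Φ n p) - h (Φ₀ p))‖ₑ ∂(μ.prod ν) := by
        refine lintegral_mono fun p => ?_
        refine le_trans (le_of_eq ?_) (enorm_add_le _ _)
        congr 1
        simp
    _ = ∫⁻ p, ‖(W n p - W₀ p) (h (Φ n p))‖ₑ ∂(μ.prod ν)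
          + ∫⁻ p, ‖W₀ p (h (Φ n p) - h (Φ₀ p))‖ₑ ∂(μ.prod ν) := by
        refine lintegral_add_right' _ ?_
        exact (integrable_clm_apply hk₀.aestronglyMeasurable hk₀.bound
          (hn.sub h0)).aestronglyMeasurable.enorm
    _ ≤ _ := by
        gcongr
        · refine (lintegral_clm_apply_le (hW n) hn.aestronglyMeasurable).trans ?_
          gcongr
          exact lintegral_comp_le_of_map_le (hk n).aemeasurable (hk n).map_le
            hh.aestronglyMeasurable
        · exact lintegral_clm_apply_le hk₀.bound (hn.sub h0).aestronglyMeasurable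

end FiberAverage

/-! ### The distance to the boundary. -/

section BoundaryDistance

variable {N : ℕ} {Ω : Set (EucSp N)}

theorem lipschitzWith_bdryDist (Ω : Set (EucSp N)) : LipschitzWith 1 (bdryDist Ω) :=
  Metric.lipschitz_infDist_pt _

theorem bdryDist_le_add_dist (Ω : Set (EucSp N)) (x y : EucSp N) :
    bdryDist Ω x ≤ bdryDist Ω y + dist x y :=
  Metric.infDist_le_infDist_add_dist

theorem frontier_nonempty_of_isBounded (hN : 0 < N) (hb : Bornology.IsBounded Ω)
    {x : EucSp N} (hx : x ∈ Ω) : (frontier Ω).Nonempty := by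
  have : Nonempty (Fin N) := ⟨⟨0, hN⟩⟩
  have : Nontrivial (EucSp N) := inferInstance
  refine nonempty_frontier_iff.2 ⟨⟨x, hx⟩, fun h => ?_⟩
  exact NormedSpace.unbounded_univ ℝ (EucSp N) (h ▸ hb)

theorem bdryDist_pos (hN : 0 < N) (ho : IsOpen Ω) (hb : Bornology.IsBounded Ω)
    {x : EucSp N} (hx : x ∈ Ω) : 0 < bdryDist Ω x :=
  (isClosed_frontier.notMem_iff_infDist_pos (frontier_nonempty_of_isBounded hN hb hx)).1
    fun h => (disjoint_frontier_iff_isOpen.2 ho).notMem_of_mem_left h hx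

/-- The ball is connected and meets `Ω`; to leave `Ω` it would have to contain a frontier point,
closer to `x` than the distance to the frontier. -/
theorem ball_bdryDist_subset (ho : IsOpen Ω) {x : EucSp N} (hx : x ∈ Ω) :
    Metric.ball x (bdryDist Ω x) ⊆ Ω := by
  rcases le_or_gt (bdryDist Ω x) 0 with h | h
  · simp [Metric.ball_eq_empty.2 h]
  refine (convex_ball x _).isPreconnected.subset_of_closure_inter_subset ho
    ⟨x, Metric.mem_ball_self h, hx⟩ fun y hy => ?_
  by_contra hyΩ
  have hyf : y ∈ frontier Ω := by rw [ho.frontier_eq]; exact ⟨hy.1, hyΩ⟩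
  have h1 : bdryDist Ω x ≤ dist x y := Metric.infDist_le_dist_of_mem hyf
  have h2 := hy.2
  rw [Metric.mem_ball, dist_comm] at h2
  linarith

theorem exists_bdryDist_le (hN : 0 < N) (hb : Bornology.IsBounded Ω) :
    ∃ D : ℝ, 1 ≤ D ∧ ∀ x ∈ Ω, bdryDist Ω x ≤ D := by
  rcases Ω.eq_empty_or_nonempty with rfl | ⟨x₀, hx₀⟩
  · exact ⟨1, le_rfl, by simp⟩
  obtain ⟨p, hp⟩ := frontier_nonempty_of_isBounded hN hb hx₀
  obtain ⟨R, hR⟩ := hb.subset_closedBall p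
  refine ⟨max 1 R, le_max_left _ _, fun x hx => ?_⟩
  exact (Metric.infDist_le_dist_of_mem hp).trans ((hR hx).trans (le_max_right _ _))

end BoundaryDistance

/-! ### The uniform bound on the pushforward under `(x, z) ↦ x - s η(x) z`. -/

section StepMap

open scoped ENNReal NNReal

variable {N : ℕ} {Ω : Set (EucSp N)}

/-- The map `(x, z) ↦ x - s η(x) z`. -/
def stepMap (η : EucSp N → ℝ) (s : ℝ) (p : EucSp N × EucSp N) : EucSp N :=
  p.1 - (s * η p.1) • p.2

/-- Lebesgue measure on the open unit ball. -/
noncomputable abbrev ballMeasure (N : ℕ) : Measure (EucSp N) :=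
  volume.restrict (Metric.ball 0 1)

instance : IsFiniteMeasure (ballMeasure N) :=
  ⟨by rw [Measure.restrict_apply_univ]; exact measure_ball_lt_top⟩

theorem volume_ball_inter_preimage_sub_smul (x : EucSp N) {t : ℝ} (ht : 0 < t)
    {A : Set (EucSp N)} (hA : MeasurableSet A) :
    volume ({z | x - t • z ∈ A} ∩ Metric.ball 0 1)
      = ENNReal.ofReal (t ^ N)⁻¹ * volume (A ∩ Metric.ball x t) := by
  have hset : {z | x - t • z ∈ A} ∩ Metric.ball (0 : EucSp N) 1
      = (t • ·) ⁻¹' ((fun y => x - y) ⁻¹' (A ∩ Metric.ball x t)) := by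
    ext z
    simp only [mem_inter_iff, mem_ofPred_eq, mem_preimage, Metric.mem_ball, dist_self_sub_left,
      dist_zero_right, norm_smul, Real.norm_eq_abs, abs_of_pos ht]
    refine and_congr_right fun _ => ?_
    constructor
    · intro h; nlinarith
    · intro h; by_contra! h'; nlinarith
  rw [hset, Measure.addHaar_preimage_smul _ ht.ne', finrank_euclideanSpace_fin,
    abs_of_pos (inv_pos.2 (pow_pos ht N)),
    (Measure.measurePreserving_sub_left volume x).measure_preimage
      (hA.inter Metric.isOpen_ball.measurableSet).nullMeasurableSet]

/-- The normalised indicator `a⁻ᴺ 1{|x - y| < K a}`. -/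
noncomputable def ballKernel (K a : ℝ) (x y : EucSp N) : ℝ≥0∞ :=
  ENNReal.ofReal (a ^ N)⁻¹ * (Metric.ball y (K * a)).indicator 1 x

/-- The factor `a⁻ᴺ` cancels the volume of a ball of radius `K a`, so the bound does not see `a`.
This lets the radius shrink with `s` and with the distance from `y` to the boundary. -/
theorem lintegral_ballKernel_le {K a : ℝ} (hK : 0 < K) (ha : 0 < a) (y : EucSp N)
    (Ω : Set (EucSp N)) :
    ∫⁻ x in Ω, ballKernel K a x y
      ≤ ENNReal.ofReal (K ^ N) * volume (Metric.ball (0 : EucSp N) 1) := by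
  calc ∫⁻ x in Ω, ballKernel K a x y ≤ ∫⁻ x, ballKernel K a x y := setLIntegral_le_lintegral _ _
    _ = ENNReal.ofReal (a ^ N)⁻¹ * volume (Metric.ball y (K * a)) := by
        simp only [ballKernel]
        rw [lintegral_const_mul _ (measurable_one.indicator Metric.isOpen_ball.measurableSet),
          lintegral_indicator_one Metric.isOpen_ball.measurableSet]
    _ = ENNReal.ofReal (K ^ N) * volume (Metric.ball (0 : EucSp N) 1) := by
        rw [Measure.addHaar_ball_of_pos _ _ (mul_pos hK ha), finrank_euclideanSpace_fin,
          ← mul_assoc,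
          ← ENNReal.ofReal_mul (by positivity)]
        congr 2
        rw [mul_pow]
        field_simp

/-- The point is to trade a radius depending on `x` for one depending on `y`, so that the integral
over `x` becomes the volume of a ball. The first summand serves points `x` near the boundary, the
second the others. -/
theorem indicator_ball_le_ballKernel_add {κ D s σx σy ηx : ℝ} (hκ : 0 < κ)
    (hs : 0 < s) (hs1 : s ≤ 1) (hσx : 0 < σx) (hD : σx ≤ D) (hσy : 0 < σy)
    (h1 : κ * σx ^ 2 ≤ ηx) (h2 : ηx ≤ σx ^ 2) (h3 : ηx ≤ σx) {x y : EucSp N}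
    (hxy : σx ≤ σy + dist x y) (hyx : σy ≤ σx + dist x y) :
    ENNReal.ofReal ((s * ηx) ^ N)⁻¹ * (Metric.ball x (s * ηx)).indicator 1 y
      ≤ ballKernel (16 / κ) (κ * s * σy ^ 2 / 4) x y
        + ballKernel (4 * D ^ 2 / κ) (κ * s / 4) x y := by
  by_cases hmem : y ∈ Metric.ball x (s * ηx)
  swap
  · simp [indicator_of_notMem hmem]
  have hd : dist x y < s * ηx := by rw [dist_comm]; exact hmem
  have hη : 0 < ηx := lt_of_lt_of_le (by positivity) h1
  have hsη : s * ηx ≤ ηx := by nlinarith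
  have hy2 : σy ≤ 2 * σx := by linarith
  rw [indicator_of_mem hmem]
  -- If `σx ≤ 1/2` then `ηx ≤ σx² ≤ σx / 2`, so `σx` and `σy` agree up to a factor 2. Hence `κ σy² /
  -- 4 ≤ ηx ≤ 4 σy²`, and the ratio of these bounds is `16 / κ`. Otherwise `κ / 4 ≤ ηx ≤ D²`, with
  -- ratio `4 D² / κ`.
  rcases le_or_gt σx (1 / 2) with hx | hx
  · refine le_trans ?_ le_self_add
    have hx2 : σx ≤ 2 * σy := by nlinarith
    have hin : x ∈ Metric.ball y (16 / κ * (κ * s * σy ^ 2 / 4)) := by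
      rw [Metric.mem_ball]
      have : 16 / κ * (κ * s * σy ^ 2 / 4) = s * (4 * σy ^ 2) := by field_simp; ring
      rw [this]
      refine hd.trans_le (mul_le_mul_of_nonneg_left ?_ hs.le)
      nlinarith
    rw [ballKernel, indicator_of_mem hin, Pi.one_apply, Pi.one_apply]
    gcongr
    have : κ * σy ^ 2 / 4 ≤ ηx := by
      nlinarith [mul_le_mul_of_nonneg_left (show σy ^ 2 ≤ 4 * σx ^ 2 by nlinarith) hκ.le]
    nlinarith [mul_le_mul_of_nonneg_left this hs.le]
  · refine le_trans ?_ le_add_self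
    have hin : x ∈ Metric.ball y (4 * D ^ 2 / κ * (κ * s / 4)) := by
      rw [Metric.mem_ball]
      have : 4 * D ^ 2 / κ * (κ * s / 4) = s * D ^ 2 := by field_simp
      rw [this]
      refine hd.trans_le (mul_le_mul_of_nonneg_left ?_ hs.le)
      nlinarith
    rw [ballKernel, indicator_of_mem hin, Pi.one_apply, Pi.one_apply]
    gcongr
    have : κ * (1 / 4) ≤ ηx := by
      nlinarith [mul_le_mul_of_nonneg_left (show 1 / 4 ≤ σx ^ 2 by nlinarith) hκ.le]
    nlinarith [mul_le_mul_of_nonneg_left this hs.le]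

theorem measurable_ballKernel {K : ℝ} {a : EucSp N → ℝ} (ha : Continuous a) :
    Measurable fun p : EucSp N × EucSp N => ballKernel K (a p.2) p.1 p.2 := by
  have hop : IsOpen {p : EucSp N × EucSp N | dist p.1 p.2 < K * a p.2} :=
    isOpen_lt (by fun_prop) (by fun_prop)
  have h1 : Measurable fun p : EucSp N × EucSp N => ENNReal.ofReal (a p.2 ^ N)⁻¹ :=
    ENNReal.measurable_ofReal.comp ((by fun_prop : Continuous fun p : EucSp N × EucSp N =>
      a p.2 ^ N).measurable.inv)
  exact h1.mul (measurable_one.indicator hop.measurableSet)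

theorem lintegral_ballKernel_add_le {K K' a a' : ℝ} (hK : 0 < K) (hK' : 0 < K') (ha : 0 < a)
    (ha' : 0 < a') (y : EucSp N) (Ω : Set (EucSp N)) :
    ∫⁻ x in Ω, (ballKernel K a x y + ballKernel K' a' x y)
      ≤ (ENNReal.ofReal (K ^ N) + ENNReal.ofReal (K' ^ N))
        * volume (Metric.ball (0 : EucSp N) 1) := by
  have hm : Measurable fun x : EucSp N => ballKernel K' a' x y :=
    (measurable_one.indicator Metric.isOpen_ball.measurableSet).const_mul _
  rw [add_mul, lintegral_add_right _ hm]
  exact add_le_add (lintegral_ballKernel_le hK ha y Ω) (lintegral_ballKernel_le hK' ha' y Ω)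

/-- A step function on `Ω`, with the constants of the quadratic condition. -/
structure IsQuadraticStep (Ω : Set (EucSp N)) (η : EucSp N → ℝ) (κ : ℝ) : Prop where
  pos : 0 < κ
  dim_pos : 0 < N
  isOpen : IsOpen Ω
  isBounded : Bornology.IsBounded Ω
  lower : ∀ x ∈ Ω, κ * bdryDist Ω x ^ 2 ≤ η x
  upper : ∀ x ∈ Ω, η x ≤ bdryDist Ω x ^ 2
  le_bdryDist : ∀ x ∈ Ω, η x ≤ bdryDist Ω x

namespace IsQuadraticStep

variable {η : EucSp N → ℝ} {κ : ℝ} (hη : IsQuadraticStep Ω η κ)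
include hη

theorem eta_pos {x : EucSp N} (hx : x ∈ Ω) : 0 < η x :=
  lt_of_lt_of_le (mul_pos hη.pos (pow_pos (bdryDist_pos hη.dim_pos hη.isOpen hη.isBounded hx) 2))
    (hη.lower x hx)

theorem dist_stepMap_le {x : EucSp N} (hx : x ∈ Ω) (z : EucSp N)
    {s : ℝ} (hs : s ∈ Icc (0 : ℝ) 1) : dist (stepMap η s (x, z)) x ≤ s * η x * ‖z‖ := by
  have := hη.eta_pos hx
  rw [stepMap, dist_eq_norm, sub_sub_cancel_left, norm_neg, norm_smul, Real.norm_eq_abs,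
    abs_of_nonneg (mul_nonneg hs.1 this.le)]

theorem stepMap_mem {x z : EucSp N} (hx : x ∈ Ω) (hz : z ∈ Metric.ball (0 : EucSp N) 1)
    {s : ℝ} (hs : s ∈ Icc (0 : ℝ) 1) : stepMap η s (x, z) ∈ Ω := by
  apply ball_bdryDist_subset hη.isOpen hx
  have h0 := hη.eta_pos hx
  have h1 := hη.le_bdryDist x hx
  have h2 := hη.dist_stepMap_le hx z hs
  rw [mem_ball_zero_iff] at hz
  rw [Metric.mem_ball]
  have h3 : s * η x ≤ η x := by nlinarith [hs.2]
  have h4 : s * η x * ‖z‖ ≤ η x * ‖z‖ := by gcongr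
  nlinarith

/-- For fixed `x` the slice rescales to the part of `A` in the ball of radius `s η(x)` about `x`,
which lies in `Ω`; the pointwise kernel bound is then integrated in `y`. -/
theorem volume_slice_stepMap_le {D : ℝ} (hD : ∀ x ∈ Ω, bdryDist Ω x ≤ D)
    {s : ℝ} (hs : 0 < s) (hs1 : s ≤ 1) {A : Set (EucSp N)} (hA : MeasurableSet A)
    {x : EucSp N} (hx : x ∈ Ω) :
    volume ({z | x - (s * η x) • z ∈ A} ∩ Metric.ball 0 1)
      ≤ ∫⁻ y in A ∩ Ω, (ballKernel (16 / κ) (κ * s * bdryDist Ω y ^ 2 / 4) x y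
        + ballKernel (4 * D ^ 2 / κ) (κ * s / 4) x y) := by
  have h0 := hη.eta_pos hx
  have hσ : ∀ {x}, x ∈ Ω → 0 < bdryDist Ω x := fun hx =>
    bdryDist_pos hη.dim_pos hη.isOpen hη.isBounded hx
  have hsub : Metric.ball x (s * η x) ⊆ Ω := by
    refine (Metric.ball_subset_ball ?_).trans (ball_bdryDist_subset hη.isOpen hx)
    have := hη.le_bdryDist x hx
    nlinarith
  have hinter : A ∩ Metric.ball x (s * η x) = Metric.ball x (s * η x) ∩ (A ∩ Ω) := by
    rw [inter_comm A Ω, ← inter_assoc, inter_eq_left.2 hsub, inter_comm]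
  have hbm : MeasurableSet (Metric.ball x (s * η x)) := Metric.isOpen_ball.measurableSet
  rw [volume_ball_inter_preimage_sub_smul x (mul_pos hs h0) hA, hinter,
    ← Measure.restrict_apply hbm, ← lintegral_indicator_one hbm,
    ← lintegral_const_mul _ (measurable_one.indicator hbm)]
  refine setLIntegral_mono' (hA.inter hη.isOpen.measurableSet) fun y hy => ?_
  refine indicator_ball_le_ballKernel_add hη.pos hs hs1 (hσ hx) (hD x hx) (hσ hy.2)
    (hη.lower x hx) (hη.upper x hx) (hη.le_bdryDist x hx) (bdryDist_le_add_dist Ω x y) ?_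
  rw [dist_comm]
  exact bdryDist_le_add_dist Ω y x

theorem map_stepMap_le_of_pos {D : ℝ} (hD1 : 1 ≤ D) (hD : ∀ x ∈ Ω, bdryDist Ω x ≤ D)
    (hηm : Measurable η)
    {s : ℝ} (hs : 0 < s) (hs1 : s ≤ 1) {A : Set (EucSp N)} (hA : MeasurableSet A) :
    ((volume.restrict Ω).prod (ballMeasure N)) (stepMap η s ⁻¹' A)
      ≤ (ENNReal.ofReal ((16 / κ) ^ N) + ENNReal.ofReal ((4 * D ^ 2 / κ) ^ N))
        * volume (Metric.ball (0 : EucSp N) 1) * volume (A ∩ Ω) := by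
  have hκ := hη.pos
  have hmeas : Measurable (stepMap η s) :=
    measurable_fst.sub (((hηm.comp measurable_fst).const_mul s).smul measurable_snd)
  have hΩm := hη.isOpen.measurableSet
  have hσc : Continuous (bdryDist Ω) := (lipschitzWith_bdryDist Ω).continuous
  have hm1 : Measurable fun p : EucSp N × EucSp N =>
      ballKernel (16 / κ) (κ * s * bdryDist Ω p.2 ^ 2 / 4) p.1 p.2 :=
    measurable_ballKernel (a := fun y => κ * s * bdryDist Ω y ^ 2 / 4) (by fun_prop)
  have hm2 : Measurable fun p : EucSp N × EucSp N =>
      ballKernel (4 * D ^ 2 / κ) (κ * s / 4) p.1 p.2 :=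
    measurable_ballKernel (a := fun _ => κ * s / 4) (by fun_prop)
  rw [Measure.prod_apply (hmeas hA)]
  calc ∫⁻ x in Ω, ballMeasure N (Prod.mk x ⁻¹' (stepMap η s ⁻¹' A))
      ≤ ∫⁻ x in Ω, ∫⁻ y in A ∩ Ω, (ballKernel (16 / κ) (κ * s * bdryDist Ω y ^ 2 / 4) x y
        + ballKernel (4 * D ^ 2 / κ) (κ * s / 4) x y) := by
        refine setLIntegral_mono' hΩm fun x hx => ?_
        rw [Measure.restrict_apply (measurable_prodMk_left (hmeas hA))]
        exact hη.volume_slice_stepMap_le hD hs hs1 hA hx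
    _ = ∫⁻ y in A ∩ Ω, ∫⁻ x in Ω, (ballKernel (16 / κ) (κ * s * bdryDist Ω y ^ 2 / 4) x y
        + ballKernel (4 * D ^ 2 / κ) (κ * s / 4) x y) :=
        lintegral_lintegral_swap (hm1.add hm2).aemeasurable
    _ ≤ ∫⁻ _ in A ∩ Ω, (ENNReal.ofReal ((16 / κ) ^ N) + ENNReal.ofReal ((4 * D ^ 2 / κ) ^ N))
        * volume (Metric.ball (0 : EucSp N) 1) := by
        refine setLIntegral_mono' (hA.inter hΩm) fun y hy => ?_
        have hy' : 0 < bdryDist Ω y := bdryDist_pos hη.dim_pos hη.isOpen hη.isBounded hy.2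
        exact lintegral_ballKernel_add_le (div_pos (by norm_num) hκ)
          (div_pos (by positivity) hκ) (by positivity) (by positivity) y Ω
    _ = (ENNReal.ofReal ((16 / κ) ^ N) + ENNReal.ofReal ((4 * D ^ 2 / κ) ^ N))
        * volume (Metric.ball (0 : EucSp N) 1) * volume (A ∩ Ω) := setLIntegral_const _ _

theorem exists_map_stepMap_le (hηc : ContinuousOn η Ω) :
    ∃ C : ℝ≥0, ∀ s ∈ Icc (0 : ℝ) 1,
      AEMeasurable (stepMap η s) ((volume.restrict Ω).prod (ballMeasure N)) ∧
      Measure.map (stepMap η s) ((volume.restrict Ω).prod (ballMeasure N))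
        ≤ (C : ℝ≥0∞) • volume.restrict Ω := by
  classical
  obtain ⟨D, hD1, hD⟩ := exists_bdryDist_le hη.dim_pos hη.isBounded
  have hΩm := hη.isOpen.measurableSet
  -- Nothing is known about `η` outside `Ω`; extension by zero makes it globally measurable and
  -- changes the step map only on a null set.
  set η' : EucSp N → ℝ := Ω.indicator η with hη'
  have hη'm : Measurable η' := by
    rw [hη', ← piecewise_eq_indicator]
    exact hηc.measurable_piecewise continuousOn_const hΩm
  have heq : ∀ x ∈ Ω, η' x = η x := fun x hx => indicator_of_mem hx η
  have hstep : IsQuadraticStep Ω η' κ :=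
    { hη with
      lower := fun x hx => (hη.lower x hx).trans (heq x hx).ge
      upper := fun x hx => (heq x hx).le.trans (hη.upper x hx)
      le_bdryDist := fun x hx => (heq x hx).le.trans (hη.le_bdryDist x hx) }
  have hmeas : ∀ s, Measurable (stepMap η' s) := fun s =>
    measurable_fst.sub (((hη'm.comp measurable_fst).const_mul s).smul measurable_snd)
  have hae : ∀ s, stepMap η' s =ᵐ[(volume.restrict Ω).prod (ballMeasure N)] stepMap η s := by
    intro s
    have h1 : ∀ᵐ x ∂(volume.restrict Ω), x ∈ Ω := ae_restrict_mem hΩm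
    filter_upwards [Measure.quasiMeasurePreserving_fst.ae h1] with p hp
    rw [stepMap, stepMap, heq _ hp]
  set V : ℝ≥0∞ := volume (Metric.ball (0 : EucSp N) 1) with hV
  have hVfin : V ≠ ⊤ := measure_ball_lt_top.ne
  set K : ℝ≥0∞ := ENNReal.ofReal ((16 / κ) ^ N) + ENNReal.ofReal ((4 * D ^ 2 / κ) ^ N) with hK
  have hKfin : K ≠ ⊤ := ENNReal.add_ne_top.2 ⟨ENNReal.ofReal_ne_top, ENNReal.ofReal_ne_top⟩
  -- `K * V` serves `s > 0`. The extra `V` serves `s = 0`, where the map is the first projection and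
  -- the pushforward is `V` times Lebesgue measure on `Ω`.
  have hCfin : (K + 1) * V ≠ ⊤ := ENNReal.mul_ne_top (by simp [hKfin]) hVfin
  refine ⟨((K + 1) * V).toNNReal, fun s hs => ⟨(hmeas s).aemeasurable.congr (hae s), ?_⟩⟩
  rw [← Measure.map_congr (hae s), ENNReal.coe_toNNReal hCfin]
  refine Measure.le_iff.2 fun A hA => ?_
  rw [Measure.map_apply (hmeas s) hA, Measure.smul_apply, smul_eq_mul, Measure.restrict_apply hA]
  rcases hs.1.eq_or_lt with rfl | hs0
  · have h0 : stepMap η' 0 ⁻¹' A = A ×ˢ univ := by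
      ext p
      simp [stepMap]
    rw [h0, Measure.prod_prod, Measure.restrict_apply hA, Measure.restrict_apply_univ, mul_comm]
    gcongr
    exact le_mul_of_one_le_left (zero_le) le_add_self
  · refine (hstep.map_stepMap_le_of_pos hD1 hD hη'm hs0 hs.2 hA).trans ?_
    exact mul_le_mul_left (mul_le_mul_left le_self_add V) _

end IsQuadraticStep

end StepMap

/-! ### The scalar weight and the weight acting on gradients. -/

section Weights

open scoped ENNReal NNReal

variable {N : ℕ} {Ω : Set (EucSp N)} {ρ η : EucSp N → ℝ}

theorem continuousOn_smulRight {P E F : Type*} [TopologicalSpace P] [NormedAddCommGroup E]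
    [NormedSpace ℝ E] [NormedAddCommGroup F] [NormedSpace ℝ F] {S : Set P} {f : P → E →L[ℝ] ℝ}
    {g : P → F} (hf : ContinuousOn f S) (hg : ContinuousOn g S) :
    ContinuousOn (fun p => (f p).smulRight (g p)) S :=
  ((ContinuousLinearMap.smulRightL ℝ E F).continuous.comp_continuousOn hf).clm_apply hg

/-- The normalisation `(∫_{B_1(0)} ρ)⁻¹`. -/
noncomputable def mollConst (ρ : EucSp N → ℝ) : ℝ :=
  (∫ z in Metric.ball (0 : EucSp N) 1, ρ z)⁻¹

/-- The weight `M_ρ ρ(z)`, acting by scalar multiplication. -/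
noncomputable def mollWeight (E : Type*) [NormedAddCommGroup E] [NormedSpace ℝ E]
    (ρ : EucSp N → ℝ) (p : EucSp N × EucSp N) : E →L[ℝ] E :=
  (mollConst ρ * ρ p.2) • ContinuousLinearMap.id ℝ E

/-- The weight `M_ρ ρ(z) (id - s ⟨z, ·⟩ ∇η(x))`, which acts on the gradient of a function
mollified with step `s η`. -/
noncomputable def gradWeight (ρ η : EucSp N → ℝ) (s : ℝ) (p : EucSp N × EucSp N) :
    EucSp N →L[ℝ] EucSp N :=
  (mollConst ρ * ρ p.2) •
    (ContinuousLinearMap.id ℝ (EucSp N) - s • (innerSL ℝ p.2).smulRight (gradient η p.1))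

theorem varMollify_eq_fiberAverage (ρ η f : EucSp N → ℝ) (s : ℝ) :
    varMollify ρ (fun x => s * η x) f
      = fiberAverage (ballMeasure N) (mollWeight ℝ ρ) (stepMap η s) f := by
  ext x
  rw [varMollify, fiberAverage, ← integral_const_mul]
  refine integral_congr_ae (Eventually.of_forall fun z => ?_)
  simp [mollWeight, mollConst, stepMap, mul_assoc]

namespace IsMollifierKernel

variable (hρ : IsMollifierKernel ρ)
include hρ

theorem hasCompactSupport : HasCompactSupport ρ :=
  HasCompactSupport.of_support_subset_isCompact (isCompact_closedBall 0 1) fun x hx => by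
    rw [mem_closedBall_zero_iff]
    by_contra! h
    exact hx ((hρ.eq_zero_iff x).2 h.le)

theorem integral_pos : 0 < ∫ z in Metric.ball (0 : EucSp N) 1, ρ z := by
  rw [setIntegral_eq_integral_of_forall_compl_eq_zero]
  · refine hρ.smooth.continuous.integral_pos_of_hasCompactSupport_nonneg_nonzero
      hρ.hasCompactSupport hρ.nonneg (x := 0) fun h => ?_
    have := (hρ.eq_zero_iff 0).1 h
    rw [norm_zero] at this
    linarith
  · intro x hx
    rw [mem_ball_zero_iff, not_lt] at hx
    exact (hρ.eq_zero_iff x).2 hx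

theorem mollConst_pos : 0 < mollConst ρ := inv_pos.2 hρ.integral_pos

theorem abs_mollConst_mul_le (z : EucSp N) : |mollConst ρ * ρ z| ≤ mollConst ρ := by
  rw [abs_of_nonneg (mul_nonneg hρ.mollConst_pos.le (hρ.nonneg z))]
  exact mul_le_of_le_one_right hρ.mollConst_pos.le (hρ.le_one z)

theorem norm_mollWeight_le (E : Type*) [NormedAddCommGroup E] [NormedSpace ℝ E]
    (p : EucSp N × EucSp N) : ‖mollWeight E ρ p‖ ≤ mollConst ρ := by
  refine ContinuousLinearMap.opNorm_le_bound _ hρ.mollConst_pos.le fun v => ?_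
  simp only [mollWeight, smul_apply, ContinuousLinearMap.id_apply, norm_smul,
    Real.norm_eq_abs]
  gcongr
  exact hρ.abs_mollConst_mul_le _

theorem continuous_mollWeight (E : Type*) [NormedAddCommGroup E] [NormedSpace ℝ E] :
    Continuous (mollWeight E ρ) := by
  have := hρ.smooth.continuous
  unfold mollWeight
  fun_prop

theorem integral_mollWeight_apply {E : Type*} [NormedAddCommGroup E] [NormedSpace ℝ E]
    [CompleteSpace E] (x : EucSp N) (v : E) :
    ∫ z, mollWeight E ρ (x, z) v ∂(ballMeasure N) = v := by
  simp only [mollWeight, smul_apply, ContinuousLinearMap.id_apply]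
  rw [integral_smul_const, integral_const_mul, mollConst, inv_mul_cancel₀ hρ.integral_pos.ne',
    one_smul]

theorem norm_gradWeight_sub_le {L : ℝ} {s : ℝ} (hs : 0 ≤ s) {p : EucSp N × EucSp N}
    (hL : ‖gradient η p.1‖ ≤ L) (hp : ‖p.2‖ ≤ 1) :
    ‖gradWeight ρ η s p - mollWeight (EucSp N) ρ p‖ ≤ s * (mollConst ρ * L) := by
  have hM := hρ.mollConst_pos
  have hL0 : 0 ≤ L := (norm_nonneg _).trans hL
  refine ContinuousLinearMap.opNorm_le_bound _ (by positivity) fun v => ?_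
  have : (gradWeight ρ η s p - mollWeight (EucSp N) ρ p) v
      = -((mollConst ρ * ρ p.2) • s • (inner ℝ p.2 v) • gradient η p.1) := by
    simp only [gradWeight, mollWeight, sub_apply,
      smul_apply, ContinuousLinearMap.id_apply,
      ContinuousLinearMap.smulRight_apply, innerSL_apply_apply, smul_sub]
    abel
  rw [this, norm_neg, norm_smul, norm_smul, norm_smul, Real.norm_eq_abs, Real.norm_eq_abs,
    abs_of_nonneg hs]
  calc |mollConst ρ * ρ p.2| * (s * (‖inner ℝ p.2 v‖ * ‖gradient η p.1‖))
      ≤ mollConst ρ * (s * ((1 * ‖v‖) * L)) := by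
        gcongr
        · exact hρ.abs_mollConst_mul_le _
        · exact (norm_inner_le_norm _ _).trans (by gcongr)
    _ = s * (mollConst ρ * L) * ‖v‖ := by ring

theorem norm_gradWeight_le {L : ℝ} {s : ℝ} (hs : s ∈ Icc (0 : ℝ) 1) {p : EucSp N × EucSp N}
    (hL : ‖gradient η p.1‖ ≤ L) (hp : ‖p.2‖ ≤ 1) :
    ‖gradWeight ρ η s p‖ ≤ mollConst ρ * (1 + L) := by
  have hM := hρ.mollConst_pos
  have hL0 : 0 ≤ L := (norm_nonneg _).trans hL
  have h1 := hρ.norm_gradWeight_sub_le hs.1 hL hp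
  have h2 := hρ.norm_mollWeight_le (EucSp N) p
  have h3 : s * (mollConst ρ * L) ≤ mollConst ρ * L :=
    mul_le_of_le_one_left (by positivity) hs.2
  calc ‖gradWeight ρ η s p‖
      = ‖(gradWeight ρ η s p - mollWeight (EucSp N) ρ p) + mollWeight (EucSp N) ρ p‖ := by
        rw [sub_add_cancel]
    _ ≤ _ := norm_add_le _ _
    _ ≤ mollConst ρ * (1 + L) := by linarith

/-- The weight is affine in `s`, with value `mollWeight` at `s = 0`, so the estimate for the pair
`1`, `0` scales by `s - t`. -/
theorem norm_gradWeight_sub_gradWeight_le {L : ℝ} {s t : ℝ} {p : EucSp N × EucSp N}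
    (hL : ‖gradient η p.1‖ ≤ L) (hp : ‖p.2‖ ≤ 1) :
    ‖gradWeight ρ η s p - gradWeight ρ η t p‖ ≤ |s - t| * (mollConst ρ * L) := by
  have h0 : gradWeight ρ η s p - gradWeight ρ η t p
      = (s - t) • (gradWeight ρ η 1 p - mollWeight (EucSp N) ρ p) := by
    simp only [gradWeight, mollWeight]
    module
  rw [h0, norm_smul, Real.norm_eq_abs]
  gcongr
  simpa using hρ.norm_gradWeight_sub_le zero_le_one hL hp

end IsMollifierKernel

theorem ae_prod_mem (hΩ : MeasurableSet Ω) :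
    ∀ᵐ p ∂((volume.restrict Ω).prod (ballMeasure N)), p ∈ Ω ×ˢ Metric.ball 0 1 := by
  rw [Measure.prod_restrict]
  exact ae_restrict_mem (hΩ.prod Metric.isOpen_ball.measurableSet)

theorem enorm_le_coe_toNNReal {E : Type*} [NormedAddCommGroup E] {x : E} {r : ℝ} (h : ‖x‖ ≤ r) :
    ‖x‖ₑ ≤ (r.toNNReal : ℝ≥0∞) := by
  rw [← ofReal_norm]
  exact ENNReal.ofReal_le_ofReal h

namespace IsQuadraticStep

variable {κ : ℝ} (hη : IsQuadraticStep Ω η κ) (hηs : ContDiffOn ℝ ∞ η Ω)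
  (hρ : IsMollifierKernel ρ)
include hη hηs hρ

theorem exists_isFiberKernel_mollWeight (E : Type*) [NormedAddCommGroup E] [NormedSpace ℝ E] :
    ∃ b C : ℝ≥0, ∀ s ∈ Icc (0 : ℝ) 1, IsFiberKernel (volume.restrict Ω) (ballMeasure N)
      (volume.restrict Ω) (mollWeight E ρ) (stepMap η s) b C := by
  obtain ⟨C, hC⟩ := hη.exists_map_stepMap_le hηs.continuousOn
  refine ⟨(mollConst ρ).toNNReal, C, fun s hs => ⟨(hC s hs).1, (hC s hs).2, ?_, ?_⟩⟩
  · exact (hρ.continuous_mollWeight E).aestronglyMeasurable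
  · exact Eventually.of_forall fun p => enorm_le_coe_toNNReal (hρ.norm_mollWeight_le E p)

/-- The bound on `∇η` is what makes this weight bounded; the transport constant is the one already
found for the step map. -/
theorem exists_isFiberKernel_gradWeight {L : ℝ} (hL : ∀ x ∈ Ω, ‖gradient η x‖ ≤ L) :
    ∃ b C : ℝ≥0, ∀ s ∈ Icc (0 : ℝ) 1, IsFiberKernel (volume.restrict Ω) (ballMeasure N)
      (volume.restrict Ω) (gradWeight ρ η s) (stepMap η s) b C := by
  obtain ⟨C, hC⟩ := hη.exists_map_stepMap_le hηs.continuousOn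
  have hΩm := hη.isOpen.measurableSet
  refine ⟨(mollConst ρ * (1 + L)).toNNReal, C, fun s hs => ⟨(hC s hs).1, (hC s hs).2, ?_, ?_⟩⟩
  · have hg : ContinuousOn (gradient η) Ω :=
      (InnerProductSpace.toDual ℝ (EucSp N)).symm.continuous.comp_continuousOn
        (hηs.continuousOn_fderiv_of_isOpen hη.isOpen (by simp))
    have hg' : ContinuousOn (fun p : EucSp N × EucSp N => gradient η p.1)
        (Ω ×ˢ Metric.ball 0 1) := hg.comp continuousOn_fst fun p hp => hp.1
    have hρc := hρ.smooth.continuous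
    rw [Measure.prod_restrict]
    refine ContinuousOn.aestronglyMeasurable ?_ (hΩm.prod Metric.isOpen_ball.measurableSet)
    unfold gradWeight
    have hc : Continuous fun p : EucSp N × EucSp N => mollConst ρ * ρ p.2 := by fun_prop
    refine hc.continuousOn.smul (continuousOn_const.sub (ContinuousOn.const_smul ?_ s))
    exact continuousOn_smulRight ((innerSL ℝ).continuous.comp continuous_snd).continuousOn hg'
  · filter_upwards [ae_prod_mem hΩm] with p hp
    exact enorm_le_coe_toNNReal (hρ.norm_gradWeight_le hs (hL _ hp.1)
      (mem_ball_zero_iff.1 hp.2).le)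

end IsQuadraticStep

end Weights

/-! ### Passage to the limit in `L¹` and in the weak gradient identity. -/

section Limits

open scoped ENNReal NNReal

variable {N : ℕ} {Ω : Set (EucSp N)}

theorem tendsto_integral_clm_apply {P E F : Type*} [MeasurableSpace P] {m : Measure P}
    [NormedAddCommGroup E] [NormedSpace ℝ E] [NormedAddCommGroup F] [NormedSpace ℝ F]
    {W : P → E →L[ℝ] F} (hW : AEStronglyMeasurable W m) {b : ℝ≥0} (hb : ∀ᵐ p ∂m, ‖W p‖ₑ ≤ b)
    {h : ℕ → P → E} {h₀ : P → E} (hh : ∀ n, Integrable (h n) m) (hh₀ : Integrable h₀ m)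
    (hlim : Tendsto (fun n => eLpNorm (h n - h₀) 1 m) atTop (𝓝 0)) :
    Tendsto (fun n => ∫ p, W p (h n p) ∂m) atTop (𝓝 (∫ p, W p (h₀ p) ∂m)) := by
  refine tendsto_integral_of_L1 _ (integrable_clm_apply hW hb hh₀).aestronglyMeasurable
    (Eventually.of_forall fun n => integrable_clm_apply hW hb (hh n)) ?_
  have hup : Tendsto (fun n => (b : ℝ≥0∞) * eLpNorm (h n - h₀) 1 m) atTop (𝓝 0) := by
    simpa using ENNReal.Tendsto.const_mul hlim (a := (b : ℝ≥0∞)) (Or.inr ENNReal.coe_ne_top)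
  refine tendsto_of_tendsto_of_tendsto_of_le_of_le tendsto_const_nhds hup
    (fun _ => zero_le) fun n => ?_
  simp only [← map_sub]
  rw [eLpNorm_one_eq_lintegral_enorm]
  exact lintegral_clm_apply_le hb ((hh n).sub hh₀).aestronglyMeasurable

theorem IsFiberKernel.tendsto_fiberAverage_apply {X Z Y E F : Type*} [MeasurableSpace X]
    [MeasurableSpace Z] [MeasurableSpace Y] [NormedAddCommGroup E] [NormedSpace ℝ E]
    [NormedAddCommGroup F] [NormedSpace ℝ F] {μ : Measure X} {ν : Measure Z} {l : Measure Y}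
    [SFinite μ] [SFinite ν] {W : X × Z → E →L[ℝ] F} {Φ : X × Z → Y} {b C : ℝ≥0}
    (hk : IsFiberKernel μ ν l W Φ b C)
    {h : ℕ → Y → E} {h₀ : Y → E} (hh : ∀ n, Integrable (h n) l) (hh₀ : Integrable h₀ l)
    (hlim : Tendsto (fun n => eLpNorm (h n - h₀) 1 l) atTop (𝓝 0)) :
    Tendsto (fun n => eLpNorm (fiberAverage ν W Φ (h n) - fiberAverage ν W Φ h₀) 1 μ)
      atTop (𝓝 0) := by
  have hup : Tendsto (fun n => (b * C : ℝ≥0∞) * eLpNorm (h n - h₀) 1 l) atTop (𝓝 0) := by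
    simpa using ENNReal.Tendsto.const_mul hlim (a := (b * C : ℝ≥0∞))
      (Or.inr (ENNReal.mul_ne_top ENNReal.coe_ne_top ENNReal.coe_ne_top))
  refine tendsto_of_tendsto_of_tendsto_of_le_of_le tendsto_const_nhds hup
    (fun _ => zero_le) fun n => ?_
  have hsub := (hh n).sub hh₀
  have h1 : fiberAverage ν W Φ (h n) - fiberAverage ν W Φ h₀
      =ᵐ[μ] fiberAverage ν W Φ (h n - h₀) := by
    filter_upwards [hk.fiberAverage_add hh₀ hsub] with x hx
    rw [add_sub_cancel] at hx
    rw [Pi.sub_apply, hx, Pi.add_apply, add_sub_cancel_left]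
  rw [eLpNorm_congr_ae h1, eLpNorm_one_eq_lintegral_enorm, eLpNorm_one_eq_lintegral_enorm]
  exact hk.lintegral_fiberAverage_le hsub

/-- Test functions and their derivatives are bounded, so both sides are continuous in `L¹`. The
identity is asked only for large `n`, since the approximations used later satisfy it from an index
depending on the support of `φ`. -/
theorem tendsto_weak_gradient_identity {φ : EucSp N → ℝ} (hφ : IsTestFn Ω φ) (v : EucSp N)
    {f : ℕ → EucSp N → ℝ} {g : ℕ → EucSp N → EucSp N} {f₀ : EucSp N → ℝ}
    {g₀ : EucSp N → EucSp N}
    (hf : ∀ n, Integrable (f n) (volume.restrict Ω)) (hf₀ : Integrable f₀ (volume.restrict Ω))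
    (hg : ∀ n, Integrable (g n) (volume.restrict Ω)) (hg₀ : Integrable g₀ (volume.restrict Ω))
    (hfl : Tendsto (fun n => eLpNorm (f n - f₀) 1 (volume.restrict Ω)) atTop (𝓝 0))
    (hgl : Tendsto (fun n => eLpNorm (g n - g₀) 1 (volume.restrict Ω)) atTop (𝓝 0))
    (h : ∀ᶠ n in atTop, ∫ x in Ω, fderiv ℝ φ x v * f n x = -∫ x in Ω, φ x * inner ℝ v (g n x)) :
    ∫ x in Ω, fderiv ℝ φ x v * f₀ x = -∫ x in Ω, φ x * inner ℝ v (g₀ x) := by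
  have hc : Continuous (fun x => fderiv ℝ φ x v) :=
    (hφ.smooth.continuous_fderiv (by simp)).clm_apply continuous_const
  have hs : HasCompactSupport (fun x => fderiv ℝ φ x v) := hφ.compact.fderiv_apply (𝕜 := ℝ) v
  obtain ⟨C, hC⟩ := hs.exists_bound_of_continuous hc
  obtain ⟨C', hC'⟩ := hφ.compact.exists_bound_of_continuous hφ.smooth.continuous
  have h1 := tendsto_integral_clm_apply (m := volume.restrict Ω) (b := C.toNNReal)
    (W := fun x => (fderiv ℝ φ x v) • ContinuousLinearMap.id ℝ ℝ)
    (hc.smul continuous_const).aestronglyMeasurable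
    (Eventually.of_forall fun x => enorm_le_coe_toNNReal <| by
      rw [norm_smul, ContinuousLinearMap.norm_id, mul_one]; exact hC x) hf hf₀ hfl
  have h2 := tendsto_integral_clm_apply (m := volume.restrict Ω) (b := (C' * ‖v‖).toNNReal)
    (W := fun x => φ x • innerSL ℝ v)
    (hφ.smooth.continuous.smul continuous_const).aestronglyMeasurable
    (Eventually.of_forall fun x => enorm_le_coe_toNNReal <| by
      rw [norm_smul, innerSL_apply_norm]; gcongr; exact hC' x) hg hg₀ hgl
  simp only [smul_apply, ContinuousLinearMap.id_apply, smul_eq_mul,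
    innerSL_apply_apply] at h1 h2
  exact tendsto_nhds_unique (h1.congr' h) h2.neg

end Limits

/-! ### The weak gradient of the average of a `C¹` function. -/

section ChainRule

open scoped ENNReal NNReal

variable {N : ℕ} {Ω : Set (EucSp N)} {ρ η : EucSp N → ℝ}

theorem IsTestFn.setIntegral_fderiv_mul {φ u : EucSp N → ℝ} (hφ : IsTestFn Ω φ) (hΩ : IsOpen Ω)
    (hu : ContDiffOn ℝ 1 u Ω) (v : EucSp N) :
    ∫ x in Ω, fderiv ℝ φ x v * u x = -∫ x in Ω, φ x * fderiv ℝ u x v := by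
  have hK := hφ.compact.isCompact
  have hφc := hφ.smooth.continuous
  have hφ'c : Continuous (fun x => fderiv ℝ φ x v) :=
    (hφ.smooth.continuous_fderiv (by simp)).clm_apply continuous_const
  have huc : ContinuousOn u (tsupport φ) := hu.continuousOn.mono hφ.support
  have hu'c : ContinuousOn (fun x => fderiv ℝ u x v) (tsupport φ) :=
    ((hu.continuousOn_fderiv_of_isOpen hΩ le_rfl).mono hφ.support).clm_apply continuousOn_const
  have hφ0 : ∀ x ∉ tsupport φ, φ x = 0 := fun x hx => image_eq_zero_of_notMem_tsupport hx
  have hφ'0 : ∀ x ∉ tsupport φ, fderiv ℝ φ x v = 0 := fun x hx => by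
    rw [fderiv_of_notMem_tsupport (𝕜 := ℝ) hx]; rfl
  have key : ∀ {w : EucSp N → ℝ}, ContinuousOn w (tsupport φ) → (∀ x ∉ tsupport φ, w x = 0) →
      Integrable w := fun hw h0 =>
    (integrableOn_iff_integrable_of_support_subset fun x hx => by
      by_contra h; exact hx (h0 x h)).1 (hw.integrableOn_compact hK)
  have h := integral_mul_fderiv_eq_neg_fderiv_mul_of_integrable (μ := (volume : Measure (EucSp N)))
    (f := φ) (g := u) (v := v)
    (key (hφ'c.continuousOn.mul huc) fun x hx => by rw [hφ'0 x hx, zero_mul])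
    (key (hφc.continuousOn.mul hu'c) fun x hx => by rw [hφ0 x hx, zero_mul])
    (key (hφc.continuousOn.mul huc) fun x hx => by rw [hφ0 x hx, zero_mul])
    (fun x _ => (hφ.smooth.differentiable (by simp)) x)
    (fun x hx => (hu.differentiableOn one_ne_zero).differentiableAt
      (hΩ.mem_nhds (hφ.support hx)))
  have e1 : ∫ x in Ω, fderiv ℝ φ x v * u x = ∫ x, fderiv ℝ φ x v * u x :=
    setIntegral_eq_integral_of_forall_compl_eq_zero fun x hx => by
      rw [hφ'0 x fun h => hx (hφ.support h), zero_mul]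
  have e2 : ∫ x in Ω, φ x * fderiv ℝ u x v = ∫ x, φ x * fderiv ℝ u x v :=
    setIntegral_eq_integral_of_forall_compl_eq_zero fun x hx => by
      rw [hφ0 x fun h => hx (hφ.support h), zero_mul]
  rw [e1, e2, h, neg_neg]

theorem real_inner_gradient_right {u : EucSp N → ℝ} (x v : EucSp N) :
    inner ℝ v (gradient u x) = fderiv ℝ u x v := by
  rw [real_inner_comm, gradient, InnerProductSpace.toDual_symm_apply]

theorem contDiffOn_stepMap {s : ℝ} (hηs : ContDiffOn ℝ ∞ η Ω) (z : EucSp N) :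
    ContDiffOn ℝ 1 (fun x => stepMap η s (x, z)) Ω :=
  contDiffOn_id.sub ((contDiffOn_const.mul (hηs.of_le (by simp))).smul contDiffOn_const)

/-- This is where the form of `gradWeight` comes from: it is `M_ρ ρ(z)` times the transpose of the
derivative `v ↦ v - s (Dη(x) v) z` of the step map in `x`. -/
theorem fderiv_comp_stepMap {s : ℝ} (hΩ : IsOpen Ω) (hηs : ContDiffOn ℝ ∞ η Ω)
    {F : EucSp N → ℝ} (hF : ContDiff ℝ 1 F) {x : EucSp N} (hx : x ∈ Ω) (z v : EucSp N) :
    (mollConst ρ * ρ z) * fderiv ℝ (fun x => F (stepMap η s (x, z))) x v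
      = inner ℝ v (gradWeight ρ η s (x, z) (gradient F (stepMap η s (x, z)))) := by
  have hη1 : HasFDerivAt η (fderiv ℝ η x) x :=
    ((hηs.differentiableOn (by simp)).differentiableAt (hΩ.mem_nhds hx)).hasFDerivAt
  have hstep : HasFDerivAt (fun x => stepMap η s (x, z))
      (ContinuousLinearMap.id ℝ (EucSp N) - (s • fderiv ℝ η x).smulRight z) x :=
    (hasFDerivAt_id x).sub ((hη1.const_mul s).smul_const z)
  have hcomp := ((hF.differentiable one_ne_zero) (stepMap η s (x, z))).hasFDerivAt.comp x hstep
  have h2 : fderiv ℝ (fun x => F (stepMap η s (x, z))) x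
      = (fderiv ℝ F (stepMap η s (x, z))).comp
        (ContinuousLinearMap.id ℝ (EucSp N) - (s • fderiv ℝ η x).smulRight z) := hcomp.fderiv
  rw [h2]
  simp only [gradWeight, smul_apply, ContinuousLinearMap.comp_apply, sub_apply,
    ContinuousLinearMap.id_apply, ContinuousLinearMap.smulRight_apply, innerSL_apply_apply,
    inner_smul_right, inner_sub_right, real_inner_gradient_right, map_sub, map_smul, smul_eq_mul]
  ring

theorem integrable_of_continuous_of_isBounded {E : Type*} [NormedAddCommGroup E]
    (hb : Bornology.IsBounded Ω) {F : EucSp N → E} (hF : Continuous F) :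
    Integrable F (volume.restrict Ω) :=
  (hF.continuousOn.integrableOn_compact hb.isCompact_closure).mono_set subset_closure

/-- Fubini brings the integral over `z` outside; for each fixed `z` the integrand is a `C¹` function
on `Ω`, to which integration by parts and the chain rule apply. -/
theorem IsQuadraticStep.weak_gradient_fiberAverage_of_contDiff {κ : ℝ}
    (hη : IsQuadraticStep Ω η κ) (hηs : ContDiffOn ℝ ∞ η Ω) {s : ℝ} {b C b' C' : ℝ≥0}
    (hk : IsFiberKernel (volume.restrict Ω) (ballMeasure N)
      (volume.restrict Ω) (mollWeight ℝ ρ) (stepMap η s) b C)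
    (hk' : IsFiberKernel (volume.restrict Ω) (ballMeasure N)
      (volume.restrict Ω) (gradWeight ρ η s) (stepMap η s) b' C')
    {φ : EucSp N → ℝ} (hφ : IsTestFn Ω φ) (v : EucSp N) {F : EucSp N → ℝ} (hF : ContDiff ℝ 1 F) :
    ∫ x in Ω, fderiv ℝ φ x v * fiberAverage (ballMeasure N) (mollWeight ℝ ρ) (stepMap η s) F x
      = -∫ x in Ω, φ x * inner ℝ v
        (fiberAverage (ballMeasure N) (gradWeight ρ η s) (stepMap η s) (gradient F) x) := by
  have hΩm := hη.isOpen.measurableSet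
  have hFi : Integrable F (volume.restrict Ω) :=
    integrable_of_continuous_of_isBounded hη.isBounded hF.continuous
  have hgF : Continuous (gradient F) :=
    (InnerProductSpace.toDual ℝ (EucSp N)).symm.continuous.comp
      (hF.continuous_fderiv one_ne_zero)
  have hGi : Integrable (gradient F) (volume.restrict Ω) :=
    integrable_of_continuous_of_isBounded hη.isBounded hgF
  have hφ'c : Continuous (fun x => fderiv ℝ φ x v) :=
    (hφ.smooth.continuous_fderiv (by simp)).clm_apply continuous_const
  have hs : HasCompactSupport (fun x => fderiv ℝ φ x v) := hφ.compact.fderiv_apply (𝕜 := ℝ) v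
  obtain ⟨c₁, hc₁⟩ := hs.exists_bound_of_continuous hφ'c
  obtain ⟨c₂, hc₂⟩ := hφ.compact.exists_bound_of_continuous hφ.smooth.continuous
  have hI := hk.integrable_integrand hFi
  have hI' := hk'.integrable_integrand hGi
  have hJ : Integrable (fun p : EucSp N × EucSp N =>
      fderiv ℝ φ p.1 v * mollWeight ℝ ρ p (F (stepMap η s p)))
      ((volume.restrict Ω).prod (ballMeasure N)) :=
    hI.bdd_mul (hφ'c.comp continuous_fst).aestronglyMeasurable
      (Eventually.of_forall fun p => hc₁ p.1)
  have hJ' : Integrable (fun p : EucSp N × EucSp N =>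
      φ p.1 * inner ℝ v (gradWeight ρ η s p (gradient F (stepMap η s p))))
      ((volume.restrict Ω).prod (ballMeasure N)) :=
    (hI'.const_inner v).bdd_mul (hφ.smooth.continuous.comp continuous_fst).aestronglyMeasurable
      (Eventually.of_forall fun p => hc₂ p.1)
  have hL : ∫ x in Ω, fderiv ℝ φ x v *
      fiberAverage (ballMeasure N) (mollWeight ℝ ρ) (stepMap η s) F x
      = ∫ z, (∫ x in Ω, fderiv ℝ φ x v * mollWeight ℝ ρ (x, z) (F (stepMap η s (x, z))))
        ∂(ballMeasure N) := by
    rw [← integral_integral_swap hJ]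
    refine integral_congr_ae (Eventually.of_forall fun x => ?_)
    exact (integral_const_mul _ _).symm
  have hR : ∫ x in Ω, φ x * inner ℝ v
      (fiberAverage (ballMeasure N) (gradWeight ρ η s) (stepMap η s) (gradient F) x)
      = ∫ z, (∫ x in Ω, φ x * inner ℝ v
        (gradWeight ρ η s (x, z) (gradient F (stepMap η s (x, z))))) ∂(ballMeasure N) := by
    rw [← integral_integral_swap hJ']
    refine integral_congr_ae ?_
    filter_upwards [hI'.prod_right_ae] with x hx
    rw [integral_const_mul, integral_inner hx, fiberAverage]
  rw [hL, hR, ← integral_neg]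
  refine integral_congr_ae (Eventually.of_forall fun z => ?_)
  have hu : ContDiffOn ℝ 1 (fun x => F (stepMap η s (x, z))) Ω :=
    hF.comp_contDiffOn (contDiffOn_stepMap hηs z)
  have h1 : ∀ x, fderiv ℝ φ x v * mollWeight ℝ ρ (x, z) (F (stepMap η s (x, z)))
      = (mollConst ρ * ρ z) * (fderiv ℝ φ x v * F (stepMap η s (x, z))) := fun x => by
    simp only [mollWeight, smul_apply, ContinuousLinearMap.id_apply, smul_eq_mul]
    ring
  simp only [h1]
  rw [integral_const_mul, hφ.setIntegral_fderiv_mul hη.isOpen hu v, mul_neg, ← integral_const_mul]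
  congr 1
  refine setIntegral_congr_fun hΩm fun x hx => ?_
  change mollConst ρ * ρ z * (φ x * fderiv ℝ (fun x => F (stepMap η s (x, z))) x v)
    = φ x * inner ℝ v (gradWeight ρ η s (x, z) (gradient F (stepMap η s (x, z))))
  rw [← fderiv_comp_stepMap hη.isOpen hηs hF hx z v]
  ring

end ChainRule

/-! ### Ordinary mollification, viewed as the step map with constant step. -/

section Mollification

open scoped ENNReal NNReal Convolution

variable {N : ℕ} {Ω : Set (EucSp N)} {ρ : EucSp N → ℝ}

/-- The rescaled kernel `M_ρ ε⁻ᴺ ρ(x / ε)`. -/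
noncomputable def scaledKernel (ρ : EucSp N → ℝ) (ε : ℝ) (x : EucSp N) : ℝ :=
  mollConst ρ * (ε ^ N)⁻¹ * ρ (ε⁻¹ • x)

theorem IsMollifierKernel.contDiff_scaledKernel (hρ : IsMollifierKernel ρ) (ε : ℝ) :
    ContDiff ℝ ∞ (scaledKernel ρ ε) :=
  contDiff_const.mul (hρ.smooth.comp (contDiff_const_smul _))

theorem IsMollifierKernel.tsupport_scaledKernel_subset (hρ : IsMollifierKernel ρ) {ε : ℝ}
    (hε : 0 < ε) : tsupport (scaledKernel ρ ε) ⊆ Metric.closedBall 0 ε := by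
  refine closure_minimal (fun x hx => ?_) Metric.isClosed_closedBall
  rw [mem_closedBall_zero_iff]
  by_contra! h
  refine hx ?_
  rw [scaledKernel, (hρ.eq_zero_iff _).2, mul_zero]
  rw [norm_smul, norm_inv, Real.norm_eq_abs, abs_of_pos hε, inv_mul_eq_div, one_le_div hε]
  exact h.le

theorem IsMollifierKernel.hasCompactSupport_scaledKernel (hρ : IsMollifierKernel ρ) {ε : ℝ}
    (hε : 0 < ε) : HasCompactSupport (scaledKernel ρ ε) :=
  HasCompactSupport.of_support_subset_isCompact (isCompact_closedBall 0 ε)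
    ((subset_tsupport _).trans (hρ.tsupport_scaledKernel_subset hε))

/-- The substitution `t = ε z` identifies convolution with a fibre average, so that smoothness can
be read off the convolution and `L¹` convergence off `tendsto_fiberAverage`. -/
theorem IsMollifierKernel.integral_scaledKernel_smul (hρ : IsMollifierKernel ρ) {E : Type*}
    [NormedAddCommGroup E] [NormedSpace ℝ E] {ε : ℝ} (hε : 0 < ε) (h : EucSp N → E)
    (x : EucSp N) :
    ∫ t, scaledKernel ρ ε t • h (x - t)
      = fiberAverage (ballMeasure N) (mollWeight E ρ) (stepMap (fun _ => 1) ε) h x := by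
  have h1 : fiberAverage (ballMeasure N) (mollWeight E ρ) (stepMap (fun _ => 1) ε) h x
      = ∫ z, (mollConst ρ * ρ z) • h (x - ε • z) := by
    rw [fiberAverage, setIntegral_eq_integral_of_forall_compl_eq_zero]
    · simp [mollWeight, stepMap]
    · intro z hz
      rw [mem_ball_zero_iff, not_lt] at hz
      simp [mollWeight, (hρ.eq_zero_iff z).2 hz]
  have h2 := Measure.integral_comp_smul volume
    (fun t : EucSp N => (mollConst ρ * ρ (ε⁻¹ • t)) • h (x - t)) ε
  simp only [inv_smul_smul₀ hε.ne'] at h2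
  rw [h1, h2, finrank_euclideanSpace_fin, abs_of_pos (by positivity), ← integral_smul]
  refine integral_congr_ae (Eventually.of_forall fun t => ?_)
  simp only [scaledKernel, smul_smul]
  congr 1
  ring

/-- With a constant step each `z` acts by a translation, which preserves volume. The target is the
whole space because the translates may leave `Ω`. -/
theorem isFiberKernel_mollWeight_volume (hρ : IsMollifierKernel ρ)
    (E : Type*) [NormedAddCommGroup E] [NormedSpace ℝ E] (ε : ℝ) :
    IsFiberKernel (volume.restrict Ω) (ballMeasure N) volume (mollWeight E ρ)
      (stepMap (fun _ => 1) ε) (mollConst ρ).toNNReal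
      (volume (Metric.ball (0 : EucSp N) 1)).toNNReal := by
  have hm : Measurable (stepMap (N := N) (fun _ => 1) ε) := by
    unfold stepMap; fun_prop
  refine ⟨hm.aemeasurable, ?_, (hρ.continuous_mollWeight E).aestronglyMeasurable,
    Eventually.of_forall fun p => enorm_le_coe_toNNReal (hρ.norm_mollWeight_le E p)⟩
  rw [ENNReal.coe_toNNReal measure_ball_lt_top.ne]
  refine Measure.le_iff.2 fun A hA => ?_
  rw [Measure.map_apply hm hA, Measure.prod_apply_symm (hm hA), Measure.smul_apply, smul_eq_mul]
  calc ∫⁻ z, (volume.restrict Ω) ((fun x => (x, z)) ⁻¹' (stepMap (fun _ => 1) ε ⁻¹' A))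
        ∂(ballMeasure N) ≤ ∫⁻ _, volume A ∂(ballMeasure N) := by
        refine lintegral_mono fun z => (Measure.restrict_apply_le _ _).trans ?_
        have : (fun x => (x, z)) ⁻¹' (stepMap (fun _ => 1) ε ⁻¹' A)
            = (fun x => x - (ε * 1) • z) ⁻¹' A := rfl
        rw [this]
        exact ((measurePreserving_sub_right volume _).measure_preimage hA.nullMeasurableSet).le
    _ = volume (Metric.ball (0 : EucSp N) 1) * volume A := by
        rw [lintegral_const, Measure.restrict_apply_univ, mul_comm]

theorem tendsto_mollification (hρ : IsMollifierKernel ρ) (hb : Bornology.IsBounded Ω)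
    {E : Type*} [NormedAddCommGroup E] [NormedSpace ℝ E] [CompleteSpace E] {h : EucSp N → E}
    (hh : Integrable h) :
    Tendsto (fun n : ℕ => eLpNorm (fiberAverage (ballMeasure N) (mollWeight E ρ)
      (stepMap (fun _ => 1) (1 / ((n : ℝ) + 1))) h - h) 1 (volume.restrict Ω)) atTop (𝓝 0) := by
  have : IsFiniteMeasure (volume.restrict Ω) := ⟨by
    rw [Measure.restrict_apply_univ]; exact hb.measure_lt_top⟩
  have h0 : fiberAverage (ballMeasure N) (mollWeight E ρ) (stepMap (fun _ => 1) 0) h = h := by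
    ext x
    simp only [fiberAverage, stepMap, zero_mul, zero_smul, sub_zero]
    exact hρ.integral_mollWeight_apply x (h x)
  have hW : ∀ n : ℕ, ∀ᵐ p ∂((volume.restrict Ω).prod (ballMeasure N)),
      ‖mollWeight E ρ p - mollWeight E ρ p‖ₑ ≤ (fun _ : ℕ => (0 : ℝ≥0∞)) n := fun n =>
    Eventually.of_forall fun p => by
      rw [sub_self]
      exact (enorm_le_coe_toNNReal (r := 0) norm_zero.le).trans (by simp)
  have := tendsto_fiberAverage
    (fun n : ℕ => isFiberKernel_mollWeight_volume hρ E (1 / ((n : ℝ) + 1)))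
    (isFiberKernel_mollWeight_volume hρ E 0) (Eventually.of_forall fun p => by
      have h1 : Tendsto (fun n : ℕ => p.1 - (1 / ((n : ℝ) + 1) * 1) • p.2) atTop
          (𝓝 (p.1 - ((0 : ℝ) * 1) • p.2)) :=
        tendsto_const_nhds.sub ((tendsto_one_div_add_atTop_nhds_zero_nat.mul_const 1).smul_const _)
      exact h1)
    (a := fun _ => 0) tendsto_const_nhds hW hh
  rwa [h0] at this

theorem IsMollifierKernel.fiberAverage_eq_convolution (hρ : IsMollifierKernel ρ) {E : Type*}
    [NormedAddCommGroup E] [NormedSpace ℝ E] {ε : ℝ} (hε : 0 < ε) (f : EucSp N → E) :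
    fiberAverage (ballMeasure N) (mollWeight E ρ) (stepMap (fun _ => 1) ε) f
      = (scaledKernel ρ ε) ⋆[ContinuousLinearMap.lsmul ℝ ℝ, volume] f := by
  ext x
  rw [← hρ.integral_scaledKernel_smul hε, convolution_lsmul]

theorem contDiff_mollification (hρ : IsMollifierKernel ρ) {ε : ℝ} (hε : 0 < ε)
    {f : EucSp N → ℝ} (hf : Integrable f) :
    ContDiff ℝ 1 (fiberAverage (ballMeasure N) (mollWeight ℝ ρ) (stepMap (fun _ => 1) ε) f) := by
  rw [hρ.fiberAverage_eq_convolution hε]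
  exact (hρ.hasCompactSupport_scaledKernel hε).contDiff_convolution_left _
    ((hρ.contDiff_scaledKernel ε).of_le (by simp)) hf.locallyIntegrable

/-- When `ε` is less than the distance from `y` to the boundary, `t ↦ scaledKernel ρ ε (y - t)` is a
test function on `Ω`; the weak gradient identity for it is the claim. -/
theorem gradient_mollification (hρ : IsMollifierKernel ρ) (hΩ : IsOpen Ω)
    {f : EucSp N → ℝ} {g : EucSp N → EucSp N} (hf : Integrable f (volume.restrict Ω))
    (hg : Integrable g (volume.restrict Ω))
    (hfg : ∀ φ, IsTestFn Ω φ → ∀ v : EucSp N,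
      ∫ x in Ω, fderiv ℝ φ x v * f x = -∫ x in Ω, φ x * inner ℝ v (g x))
    {ε : ℝ} (hε : 0 < ε) {y : EucSp N} (hy : y ∈ Ω) (hεy : ε < bdryDist Ω y) :
    gradient (fiberAverage (ballMeasure N) (mollWeight ℝ ρ) (stepMap (fun _ => 1) ε)
        (Ω.indicator f)) y
      = fiberAverage (ballMeasure N) (mollWeight (EucSp N) ρ) (stepMap (fun _ => 1) ε)
        (Ω.indicator g) y := by
  have hf1 : Integrable (Ω.indicator f) := (integrable_indicator_iff hΩ.measurableSet).2 hf
  have hg1 : Integrable (Ω.indicator g) := (integrable_indicator_iff hΩ.measurableSet).2 hg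
  have hψs := hρ.contDiff_scaledKernel ε
  have hψc := hρ.hasCompactSupport_scaledKernel hε
  have hψd : Differentiable ℝ (scaledKernel ρ ε) := hψs.differentiable (by simp)
  have hsub : ContDiff ℝ ∞ (fun t : EucSp N => y - t) := contDiff_const.sub contDiff_id
  have htest : IsTestFn Ω (fun t => scaledKernel ρ ε (y - t)) := by
    have hsupp : tsupport (fun t => scaledKernel ρ ε (y - t)) ⊆ Metric.closedBall y ε := by
      refine (tsupport_comp_subset_preimage (scaledKernel ρ ε) hsub.continuous).trans fun t ht => ?_
      have := hρ.tsupport_scaledKernel_subset hε ht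
      rwa [mem_closedBall_zero_iff, ← dist_eq_norm, dist_comm] at this
    exact ⟨hψs.comp hsub, (isCompact_closedBall y ε).of_isClosed_subset (isClosed_tsupport _) hsupp,
      hsupp.trans ((Metric.closedBall_subset_ball hεy).trans (ball_bdryDist_subset hΩ hy))⟩
  refine ext_inner_left ℝ fun v => ?_
  have hdφ : ∀ t, fderiv ℝ (fun t => scaledKernel ρ ε (y - t)) t v
      = -fderiv ℝ (scaledKernel ρ ε) (y - t) v := fun t => by
    have := (hψd (y - t)).hasFDerivAt.comp t ((hasFDerivAt_id t).const_sub y)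
    have h2 : fderiv ℝ (fun t => scaledKernel ρ ε (y - t)) t
      = (fderiv ℝ (scaledKernel ρ ε) (y - t)).comp (-ContinuousLinearMap.id ℝ (EucSp N)) :=
      this.fderiv
    rw [h2]
    simp
  have hderiv : fderiv ℝ (fiberAverage (ballMeasure N) (mollWeight ℝ ρ) (stepMap (fun _ => 1) ε)
      (Ω.indicator f)) y v = ∫ t, fderiv ℝ (scaledKernel ρ ε) t v * Ω.indicator f (y - t) := by
    rw [hρ.fiberAverage_eq_convolution hε,
      (hψc.hasFDerivAt_convolution_left (ContinuousLinearMap.lsmul ℝ ℝ) (hψs.of_le (by simp))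
        hf1.locallyIntegrable y).fderiv]
    have hint := (hψc.fderiv ℝ).convolutionExists_left (μ := volume)
      ((ContinuousLinearMap.lsmul ℝ ℝ).precompL (EucSp N))
      (hψs.continuous_fderiv (by simp)) hf1.locallyIntegrable y
    rw [convolution, ContinuousLinearMap.integral_apply hint]
    rfl
  have hinner : inner ℝ v (fiberAverage (ballMeasure N) (mollWeight (EucSp N) ρ)
      (stepMap (fun _ => 1) ε) (Ω.indicator g) y)
      = ∫ t, scaledKernel ρ ε t * inner ℝ v (Ω.indicator g (y - t)) := by
    have hint := hψc.convolutionExists_left (μ := volume)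
      (ContinuousLinearMap.lsmul ℝ ℝ (E := EucSp N)) hψs.continuous hg1.locallyIntegrable y
    rw [← hρ.integral_scaledKernel_smul hε, ← integral_inner (f := fun t =>
      scaledKernel ρ ε t • Ω.indicator g (y - t)) hint]
    refine integral_congr_ae (Eventually.of_forall fun t => ?_)
    exact inner_smul_right _ _ _
  have hs1 := integral_sub_left_eq_self
    (fun t => fderiv ℝ (scaledKernel ρ ε) (y - t) v * Ω.indicator f t) volume y
  have hs2 := integral_sub_left_eq_self
    (fun t => scaledKernel ρ ε (y - t) * inner ℝ v (Ω.indicator g t)) volume y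
  simp only [sub_sub_cancel] at hs1 hs2
  rw [real_inner_gradient_right, hderiv, hinner, hs1, hs2]
  have h := hfg _ htest v
  simp only [hdφ, neg_mul, integral_neg, neg_inj] at h
  have e1 : ∫ t in Ω, fderiv ℝ (scaledKernel ρ ε) (y - t) v * f t
      = ∫ t, fderiv ℝ (scaledKernel ρ ε) (y - t) v * Ω.indicator f t := by
    rw [← integral_indicator hΩ.measurableSet]
    congr 1 with t
    by_cases ht : t ∈ Ω <;> simp [ht]
  have e2 : ∫ t in Ω, scaledKernel ρ ε (y - t) * inner ℝ v (g t)
      = ∫ t, scaledKernel ρ ε (y - t) * inner ℝ v (Ω.indicator g t) := by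
    rw [← integral_indicator hΩ.measurableSet]
    congr 1 with t
    by_cases ht : t ∈ Ω <;> simp [ht]
  rw [← e1, ← e2, h]

end Mollification

/-! ### The weak gradient of the average of a Sobolev function. -/

section WeakGradient

open scoped ENNReal NNReal

variable {N : ℕ} {Ω : Set (EucSp N)} {ρ η : EucSp N → ℝ}

theorem tendsto_stepMap (η : EucSp N → ℝ) {s : ℕ → ℝ} {s₀ : ℝ} (hs : Tendsto s atTop (𝓝 s₀))
    (p : EucSp N × EucSp N) :
    Tendsto (fun n => stepMap η (s n) p) atTop (𝓝 (stepMap η s₀ p)) :=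
  tendsto_const_nhds.sub ((hs.mul_const _).smul_const _)

namespace IsQuadraticStep

variable {κ : ℝ} (hη : IsQuadraticStep Ω η κ)
include hη

theorem isFiniteMeasure_restrict : IsFiniteMeasure (volume.restrict Ω) :=
  ⟨by rw [Measure.restrict_apply_univ]; exact hη.isBounded.measure_lt_top⟩

theorem le_bdryDist_stepMap {x z : EucSp N} (hx : x ∈ Ω) (hz : z ∈ Metric.ball (0 : EucSp N) 1)
    {s : ℝ} (hs : s ∈ Icc (0 : ℝ) 1) :
    (1 - s) * bdryDist Ω x ≤ bdryDist Ω (stepMap η s (x, z)) := by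
  have h0 := hη.eta_pos hx
  have h1 := hη.le_bdryDist x hx
  have h2 := hη.dist_stepMap_le hx z hs
  have h3 := bdryDist_le_add_dist Ω x (stepMap η s (x, z))
  rw [dist_comm] at h3
  rw [mem_ball_zero_iff] at hz
  have h4 : s * η x * ‖z‖ ≤ s * η x * 1 :=
    mul_le_mul_of_nonneg_left hz.le (mul_nonneg hs.1 h0.le)
  have h5 : s * η x ≤ s * bdryDist Ω x := mul_le_mul_of_nonneg_left h1 hs.1
  linarith

/-- Mollifications of the zero extension of `f` are `C¹`, but their gradients are mollifications of
`g` only away from the boundary. For `s < 1` the step map sends the support of `φ` into a region at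
positive distance from it. -/
theorem weak_gradient_fiberAverage_of_lt_one (hηs : ContDiffOn ℝ ∞ η Ω)
    (hρ : IsMollifierKernel ρ) {s : ℝ} (hs : s ∈ Icc (0 : ℝ) 1) (hs1 : s < 1) {b C b' C' : ℝ≥0}
    (hk : IsFiberKernel (volume.restrict Ω) (ballMeasure N)
      (volume.restrict Ω) (mollWeight ℝ ρ) (stepMap η s) b C)
    (hk' : IsFiberKernel (volume.restrict Ω) (ballMeasure N)
      (volume.restrict Ω) (gradWeight ρ η s) (stepMap η s) b' C')
    {f : EucSp N → ℝ} {g : EucSp N → EucSp N} (hf : Integrable f (volume.restrict Ω))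
    (hg : Integrable g (volume.restrict Ω))
    (hfg : ∀ φ, IsTestFn Ω φ → ∀ v : EucSp N,
      ∫ x in Ω, fderiv ℝ φ x v * f x = -∫ x in Ω, φ x * inner ℝ v (g x))
    {φ : EucSp N → ℝ} (hφ : IsTestFn Ω φ) (v : EucSp N) :
    ∫ x in Ω, fderiv ℝ φ x v * fiberAverage (ballMeasure N) (mollWeight ℝ ρ) (stepMap η s) f x
      = -∫ x in Ω, φ x * inner ℝ v
        (fiberAverage (ballMeasure N) (gradWeight ρ η s) (stepMap η s) g x) := by
  have hΩm := hη.isOpen.measurableSet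
  have := hη.isFiniteMeasure_restrict
  have hf1 : Integrable (Ω.indicator f) := (integrable_indicator_iff hΩm).2 hf
  have hg1 : Integrable (Ω.indicator g) := (integrable_indicator_iff hΩm).2 hg
  set fn : ℕ → EucSp N → ℝ := fun n => fiberAverage (ballMeasure N) (mollWeight ℝ ρ)
    (stepMap (fun _ => 1) (1 / ((n : ℝ) + 1))) (Ω.indicator f) with hfn
  set gn : ℕ → EucSp N → EucSp N := fun n => fiberAverage (ballMeasure N)
    (mollWeight (EucSp N) ρ) (stepMap (fun _ => 1) (1 / ((n : ℝ) + 1))) (Ω.indicator g) with hgn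
  have hfi : ∀ n, Integrable (fn n) (volume.restrict Ω) := fun n =>
    (isFiberKernel_mollWeight_volume hρ ℝ _).integrable_fiberAverage hf1
  have hgi : ∀ n, Integrable (gn n) (volume.restrict Ω) := fun n =>
    (isFiberKernel_mollWeight_volume hρ (EucSp N) _).integrable_fiberAverage hg1
  have hfl : Tendsto (fun n => eLpNorm (fn n - f) 1 (volume.restrict Ω)) atTop (𝓝 0) := by
    refine (tendsto_mollification hρ hη.isBounded hf1).congr fun n => eLpNorm_congr_ae ?_
    filter_upwards [ae_restrict_mem hΩm] with x hx
    simp only [Pi.sub_apply, indicator_of_mem hx, hfn]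
  have hgl : Tendsto (fun n => eLpNorm (gn n - g) 1 (volume.restrict Ω)) atTop (𝓝 0) := by
    refine (tendsto_mollification hρ hη.isBounded hg1).congr fun n => eLpNorm_congr_ae ?_
    filter_upwards [ae_restrict_mem hΩm] with x hx
    simp only [Pi.sub_apply, indicator_of_mem hx, hgn]
  refine tendsto_weak_gradient_identity hφ v
    (fun n => hk.integrable_fiberAverage (hfi n)) (hk.integrable_fiberAverage hf)
    (fun n => hk'.integrable_fiberAverage (hgi n)) (hk'.integrable_fiberAverage hg)
    (hk.tendsto_fiberAverage_apply hfi hf hfl) (hk'.tendsto_fiberAverage_apply hgi hg hgl) ?_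
  obtain ⟨δ, hδ, hδφ⟩ : ∃ δ : ℝ, 0 < δ ∧ ∀ x ∈ tsupport φ, δ ≤ bdryDist Ω x := by
    rcases (tsupport φ).eq_empty_or_nonempty with h | h
    · exact ⟨1, one_pos, by simp [h]⟩
    · obtain ⟨x₀, hx₀, hmin⟩ := hφ.compact.isCompact.exists_isMinOn h
        (lipschitzWith_bdryDist Ω).continuous.continuousOn
      exact ⟨bdryDist Ω x₀, bdryDist_pos hη.dim_pos hη.isOpen hη.isBounded (hφ.support hx₀),
        fun x hx => hmin hx⟩
  -- By `le_bdryDist_stepMap`, points over the support of `φ` land at distance at least `(1 - s) *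
  -- δ` from the boundary, so smaller mollification radii are admissible there.
  have hsδ : 0 < (1 - s) * δ := mul_pos (sub_pos.2 hs1) hδ
  filter_upwards [tendsto_one_div_add_atTop_nhds_zero_nat.eventually (gt_mem_nhds hsδ)] with n hn
  have hε : (0 : ℝ) < 1 / ((n : ℝ) + 1) := by positivity
  rw [hη.weak_gradient_fiberAverage_of_contDiff hηs hk hk' hφ v
    (contDiff_mollification hρ hε hf1)]
  congr 1
  refine setIntegral_congr_fun hΩm fun x hx => ?_
  by_cases hxφ : x ∈ tsupport φ
  · have : fiberAverage (ballMeasure N) (gradWeight ρ η s) (stepMap η s) (gradient (fn n)) x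
        = fiberAverage (ballMeasure N) (gradWeight ρ η s) (stepMap η s) (gn n) x := by
      refine setIntegral_congr_fun Metric.isOpen_ball.measurableSet fun z hz => ?_
      have hy := hη.stepMap_mem hx hz hs
      have hlt : 1 / ((n : ℝ) + 1) < bdryDist Ω (stepMap η s (x, z)) := by
        refine hn.trans_le ((mul_le_mul_of_nonneg_left (hδφ x hxφ) (sub_nonneg.2 hs.2)).trans ?_)
        exact hη.le_bdryDist_stepMap hx hz hs
      have := gradient_mollification hρ hη.isOpen hf hg hfg hε hy hlt
      exact congrArg (gradWeight ρ η s (x, z)) this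
    exact congrArg (fun w => φ x * inner ℝ v w) this
  · simp [image_eq_zero_of_notMem_tsupport hxφ]

theorem tendsto_fiberAverage_mollWeight {E : Type*} [NormedAddCommGroup E] [NormedSpace ℝ E]
    {b C : ℝ≥0}
    (hk : ∀ s ∈ Icc (0 : ℝ) 1, IsFiberKernel (volume.restrict Ω) (ballMeasure N)
      (volume.restrict Ω) (mollWeight E ρ) (stepMap η s) b C)
    {s : ℕ → ℝ} {s₀ : ℝ} (hs : ∀ n, s n ∈ Icc (0 : ℝ) 1) (hs₀ : s₀ ∈ Icc (0 : ℝ) 1)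
    (hlim : Tendsto s atTop (𝓝 s₀)) {f : EucSp N → E} (hf : Integrable f (volume.restrict Ω)) :
    Tendsto (fun n => eLpNorm (fiberAverage (ballMeasure N) (mollWeight E ρ) (stepMap η (s n)) f
      - fiberAverage (ballMeasure N) (mollWeight E ρ) (stepMap η s₀) f) 1 (volume.restrict Ω))
      atTop (𝓝 0) := by
  have := hη.isFiniteMeasure_restrict
  have hW : ∀ n : ℕ, ∀ᵐ p ∂((volume.restrict Ω).prod (ballMeasure N)),
      ‖mollWeight E ρ p - mollWeight E ρ p‖ₑ ≤ (fun _ : ℕ => (0 : ℝ≥0∞)) n := fun n =>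
    Eventually.of_forall fun p => by
      rw [sub_self]
      exact (enorm_le_coe_toNNReal (r := 0) norm_zero.le).trans (by simp)
  exact tendsto_fiberAverage (fun n => hk (s n) (hs n)) (hk s₀ hs₀)
    (Eventually.of_forall (tendsto_stepMap η hlim)) tendsto_const_nhds hW hf

theorem tendsto_fiberAverage_gradWeight (hρ : IsMollifierKernel ρ) {L : ℝ}
    (hL : ∀ x ∈ Ω, ‖gradient η x‖ ≤ L) {b C : ℝ≥0}
    (hk : ∀ s ∈ Icc (0 : ℝ) 1, IsFiberKernel (volume.restrict Ω) (ballMeasure N)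
      (volume.restrict Ω) (gradWeight ρ η s) (stepMap η s) b C)
    {s : ℕ → ℝ} {s₀ : ℝ} (hs : ∀ n, s n ∈ Icc (0 : ℝ) 1) (hs₀ : s₀ ∈ Icc (0 : ℝ) 1)
    (hlim : Tendsto s atTop (𝓝 s₀)) {g : EucSp N → EucSp N}
    (hg : Integrable g (volume.restrict Ω)) :
    Tendsto (fun n => eLpNorm (fiberAverage (ballMeasure N) (gradWeight ρ η (s n))
        (stepMap η (s n)) g
      - fiberAverage (ballMeasure N) (gradWeight ρ η s₀) (stepMap η s₀) g) 1 (volume.restrict Ω))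
      atTop (𝓝 0) := by
  have := hη.isFiniteMeasure_restrict
  have hW : ∀ n : ℕ, ∀ᵐ p ∂((volume.restrict Ω).prod (ballMeasure N)),
      ‖gradWeight ρ η (s n) p - gradWeight ρ η s₀ p‖ₑ
        ≤ ENNReal.ofReal (|s n - s₀| * (mollConst ρ * L)) := fun n => by
    filter_upwards [ae_prod_mem hη.isOpen.measurableSet] with p hp
    exact enorm_le_coe_toNNReal (hρ.norm_gradWeight_sub_gradWeight_le (hL _ hp.1)
      (mem_ball_zero_iff.1 hp.2).le)
  have ha : Tendsto (fun n => ENNReal.ofReal (|s n - s₀| * (mollConst ρ * L))) atTop (𝓝 0) := by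
    have h1 : Tendsto (fun n => |s n - s₀| * (mollConst ρ * L)) atTop
        (𝓝 (|s₀ - s₀| * (mollConst ρ * L))) := ((hlim.sub_const s₀).abs).mul_const _
    simpa using ENNReal.tendsto_ofReal h1
  exact tendsto_fiberAverage (fun n => hk (s n) (hs n)) (hk s₀ hs₀)
    (Eventually.of_forall (tendsto_stepMap η hlim)) ha hW hg

/-- At `s = 1` the margin `(1 - s) δ` disappears, so the identity is obtained as the limit of those
for parameters `t n < 1` tending to `s`. -/
theorem weak_gradient_fiberAverage (hηs : ContDiffOn ℝ ∞ η Ω)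
    (hρ : IsMollifierKernel ρ) {L : ℝ} (hL : ∀ x ∈ Ω, ‖gradient η x‖ ≤ L)
    {s : ℝ} (hs : s ∈ Icc (0 : ℝ) 1)
    {f : EucSp N → ℝ} {g : EucSp N → EucSp N} (hf : Integrable f (volume.restrict Ω))
    (hg : Integrable g (volume.restrict Ω))
    (hfg : ∀ φ, IsTestFn Ω φ → ∀ v : EucSp N,
      ∫ x in Ω, fderiv ℝ φ x v * f x = -∫ x in Ω, φ x * inner ℝ v (g x))
    {φ : EucSp N → ℝ} (hφ : IsTestFn Ω φ) (v : EucSp N) :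
    ∫ x in Ω, fderiv ℝ φ x v * fiberAverage (ballMeasure N) (mollWeight ℝ ρ) (stepMap η s) f x
      = -∫ x in Ω, φ x * inner ℝ v
        (fiberAverage (ballMeasure N) (gradWeight ρ η s) (stepMap η s) g x) := by
  obtain ⟨b, C, hk⟩ := hη.exists_isFiberKernel_mollWeight hηs hρ ℝ
  obtain ⟨b', C', hk'⟩ := hη.exists_isFiberKernel_gradWeight hηs hρ hL
  set t : ℕ → ℝ := fun n => (1 - 1 / ((n : ℝ) + 1)) * s with ht
  have h1 : ∀ n : ℕ, 0 < 1 / ((n : ℝ) + 1) ∧ 1 / ((n : ℝ) + 1) ≤ 1 := fun n =>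
    ⟨by positivity, by rw [div_le_one (by positivity)]; linarith [n.cast_nonneg (α := ℝ)]⟩
  have htm : ∀ n, t n ∈ Icc (0 : ℝ) 1 ∧ t n < 1 := fun n => by
    obtain ⟨h2, h3⟩ := h1 n
    have h4 : t n ≤ (1 - 1 / ((n : ℝ) + 1)) * 1 :=
      mul_le_mul_of_nonneg_left hs.2 (by linarith)
    exact ⟨⟨mul_nonneg (by linarith) hs.1, by linarith⟩, by linarith⟩
  have htl : Tendsto t atTop (𝓝 s) := by
    have := (tendsto_one_div_add_atTop_nhds_zero_nat (𝕜 := ℝ)).const_sub 1 |>.mul_const s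
    simpa [ht] using this
  exact tendsto_weak_gradient_identity hφ v
    (fun n => (hk _ (htm n).1).integrable_fiberAverage hf) ((hk s hs).integrable_fiberAverage hf)
    (fun n => (hk' _ (htm n).1).integrable_fiberAverage hg) ((hk' s hs).integrable_fiberAverage hg)
    (hη.tendsto_fiberAverage_mollWeight hk (fun n => (htm n).1) hs htl hf)
    (hη.tendsto_fiberAverage_gradWeight hρ hL hk' (fun n => (htm n).1) hs htl hg)
    (Eventually.of_forall fun n => hη.weak_gradient_fiberAverage_of_lt_one hηs hρ (htm n).1
      (htm n).2 (hk _ (htm n).1) (hk' _ (htm n).1) hf hg hfg hφ v)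

end IsQuadraticStep

end WeakGradient

/-! ### The operators on `L¹` and on `W^{1,1}`. -/

section Operator

open scoped ENNReal NNReal

variable {N : ℕ} {Ω : Set (EucSp N)} {ρ η : EucSp N → ℝ}

/-- A pair of bounded operators on `L¹(Ω)` and `L¹(Ω; ℝᴺ)` that maps pairs `(f, ∇f)` to such
pairs, as a bounded operator on `W^{1,1}(Ω)`. -/
noncomputable def W11.mapCLM
    (A : Lp ℝ 1 (volume.restrict Ω) →L[ℝ] Lp ℝ 1 (volume.restrict Ω))
    (B : Lp (EucSp N) 1 (volume.restrict Ω) →L[ℝ] Lp (EucSp N) 1 (volume.restrict Ω))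
    (hAB : ∀ f g, HasWeakGradient Ω f g → HasWeakGradient Ω (A f) (B g)) : W11 Ω →L[ℝ] W11 Ω :=
  (((WithLp.prodContinuousLinearEquiv 1 ℝ _ _).symm.toContinuousLinearMap.comp
    ((A.prodMap B).comp (WithLp.prodContinuousLinearEquiv 1 ℝ _ _).toContinuousLinearMap)).comp
      (W11 Ω).subtypeL).codRestrict (W11 Ω) fun u => hAB _ _ u.2

@[simp]
theorem W11.mapCLM_fst
    (A : Lp ℝ 1 (volume.restrict Ω) →L[ℝ] Lp ℝ 1 (volume.restrict Ω))
    (B : Lp (EucSp N) 1 (volume.restrict Ω) →L[ℝ] Lp (EucSp N) 1 (volume.restrict Ω))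
    (hAB : ∀ f g, HasWeakGradient Ω f g → HasWeakGradient Ω (A f) (B g)) (u : W11 Ω) :
    (W11.mapCLM A B hAB u).1.fst = A u.1.fst := rfl

@[simp]
theorem W11.mapCLM_snd
    (A : Lp ℝ 1 (volume.restrict Ω) →L[ℝ] Lp ℝ 1 (volume.restrict Ω))
    (B : Lp (EucSp N) 1 (volume.restrict Ω) →L[ℝ] Lp (EucSp N) 1 (volume.restrict Ω))
    (hAB : ∀ f g, HasWeakGradient Ω f g → HasWeakGradient Ω (A f) (B g)) (u : W11 Ω) :
    (W11.mapCLM A B hAB u).1.snd = B u.1.snd := rfl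

theorem hasWeakGradient_of_ae_eq {f : Lp ℝ 1 (volume.restrict Ω)}
    {g : Lp (EucSp N) 1 (volume.restrict Ω)} {f' : EucSp N → ℝ} {g' : EucSp N → EucSp N}
    (hf : f =ᵐ[volume.restrict Ω] f') (hg : g =ᵐ[volume.restrict Ω] g')
    (h : ∀ φ, IsTestFn Ω φ → ∀ v : EucSp N,
      ∫ x in Ω, fderiv ℝ φ x v * f' x = -∫ x in Ω, φ x * inner ℝ v (g' x)) :
    HasWeakGradient Ω f g := by
  intro φ hφ v
  have h1 : ∫ x in Ω, fderiv ℝ φ x v * f x = ∫ x in Ω, fderiv ℝ φ x v * f' x := by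
    refine integral_congr_ae ?_
    filter_upwards [hf] with x hx
    rw [hx]
  have h2 : ∫ x in Ω, φ x * inner ℝ v (g x) = ∫ x in Ω, φ x * inner ℝ v (g' x) := by
    refine integral_congr_ae ?_
    filter_upwards [hg] with x hx
    rw [hx]
  rw [h1, h2, h φ hφ v]

theorem tendsto_Lp_of_ae_eq {P E : Type*} [MeasurableSpace P] {m : Measure P}
    [NormedAddCommGroup E] {F : ℕ → Lp E 1 m} {G : ℕ → P → E} {u : Lp E 1 m}
    (hF : ∀ n, F n =ᵐ[m] G n)
    (hG : Tendsto (fun n => eLpNorm (G n - (u : P → E)) 1 m) atTop (𝓝 0)) :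
    Tendsto F atTop (𝓝 u) := by
  rw [Lp.tendsto_Lp_iff_tendsto_eLpNorm']
  exact hG.congr fun n => eLpNorm_congr_ae ((hF n).symm.sub EventuallyEq.rfl)

theorem W11.tendsto_of_tendsto {w : ℕ → W11 Ω} {u : W11 Ω}
    (h₁ : Tendsto (fun n => (w n).1.fst) atTop (𝓝 u.1.fst))
    (h₂ : Tendsto (fun n => (w n).1.snd) atTop (𝓝 u.1.snd)) : Tendsto w atTop (𝓝 u) := by
  rw [tendsto_subtype_rng]
  exact ((WithLp.prodContinuousLinearEquiv 1 ℝ (Lp ℝ 1 (volume.restrict Ω))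
    (Lp (EucSp N) 1 (volume.restrict Ω))).symm.continuous.tendsto
      (u.1.fst, u.1.snd)).comp (h₁.prodMk_nhds h₂)

theorem IsMollifierKernel.fiberAverage_stepMap_zero (hρ : IsMollifierKernel ρ) {E : Type*}
    [NormedAddCommGroup E] [NormedSpace ℝ E] [CompleteSpace E] (η : EucSp N → ℝ)
    (f : EucSp N → E) :
    fiberAverage (ballMeasure N) (mollWeight E ρ) (stepMap η 0) f = f := by
  ext x
  simp only [fiberAverage, stepMap, zero_mul, zero_smul, sub_zero]
  exact hρ.integral_mollWeight_apply x (f x)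

theorem fiberAverage_gradWeight_stepMap_zero (hρ : IsMollifierKernel ρ) (η : EucSp N → ℝ)
    (g : EucSp N → EucSp N) :
    fiberAverage (ballMeasure N) (gradWeight ρ η 0) (stepMap η 0) g = g := by
  have h : gradWeight ρ η 0 = mollWeight (EucSp N) ρ := by
    ext p : 1
    simp [gradWeight, mollWeight]
  rw [h, hρ.fiberAverage_stepMap_zero]

theorem norm_gradient (u : EucSp N → ℝ) (x : EucSp N) : ‖gradient u x‖ = ‖fderiv ℝ u x‖ :=
  LinearIsometryEquiv.norm_map _ _

theorem varMollifySeq_eq_fiberAverage (ρ η : EucSp N → ℝ) (n : ℕ) (f : EucSp N → ℝ) :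
    varMollifySeq ρ η n f
      = fiberAverage (ballMeasure N) (mollWeight ℝ ρ) (stepMap η (n : ℝ)⁻¹) f := by
  rw [← varMollify_eq_fiberAverage, varMollifySeq]
  simp only [div_eq_inv_mul]

/-- The index `n = 0` is included: its inverse is `0` by convention, and the operator is then the
identity. -/
theorem inv_natCast_mem_Icc (n : ℕ) : (n : ℝ)⁻¹ ∈ Icc (0 : ℝ) 1 :=
  ⟨by positivity, Nat.cast_inv_le_one n⟩

namespace IsQuadraticStep

variable {κ : ℝ} (hη : IsQuadraticStep Ω η κ)
include hη

theorem memLp_varMollifySeq (hηs : ContDiffOn ℝ ∞ η Ω) (hρ : IsMollifierKernel ρ)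
    {f : EucSp N → ℝ} (hf : MemLp f 1 (volume.restrict Ω)) (n : ℕ) :
    MemLp (varMollifySeq ρ η n f) 1 (volume.restrict Ω) := by
  obtain ⟨b, C, hk⟩ := hη.exists_isFiberKernel_mollWeight hηs hρ ℝ
  rw [varMollifySeq_eq_fiberAverage, memLp_one_iff_integrable]
  exact (hk _ (inv_natCast_mem_Icc n)).integrable_fiberAverage (memLp_one_iff_integrable.1 hf)

theorem tendsto_varMollifySeq (hηs : ContDiffOn ℝ ∞ η Ω) (hρ : IsMollifierKernel ρ)
    {f : EucSp N → ℝ} (hf : MemLp f 1 (volume.restrict Ω)) :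
    Tendsto (fun n : ℕ => eLpNorm (varMollifySeq ρ η n f - f) 1 (volume.restrict Ω))
      atTop (𝓝 0) := by
  obtain ⟨b, C, hk⟩ := hη.exists_isFiberKernel_mollWeight hηs hρ ℝ
  have := hη.tendsto_fiberAverage_mollWeight hk inv_natCast_mem_Icc
    (left_mem_Icc.2 zero_le_one) (tendsto_inv_atTop_nhds_zero_nat (𝕜 := ℝ))
    (memLp_one_iff_integrable.1 hf)
  rw [hρ.fiberAverage_stepMap_zero] at this
  simpa only [varMollifySeq_eq_fiberAverage] using this

/-- The function is averaged with `mollWeight` and its gradient with `gradWeight`; the weak gradient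
identity says that this pair of operators preserves `W11 Ω`. Constants uniform in `s` give the
convergence in both components. -/
theorem exists_W11_operators (hηs : ContDiffOn ℝ ∞ η Ω) (hρ : IsMollifierKernel ρ)
    {L : ℝ} (hL : ∀ x ∈ Ω, ‖gradient η x‖ ≤ L) {b C b' C' : ℝ≥0}
    (hk : ∀ s ∈ Icc (0 : ℝ) 1, IsFiberKernel (volume.restrict Ω) (ballMeasure N)
      (volume.restrict Ω) (mollWeight ℝ ρ) (stepMap η s) b C)
    (hk' : ∀ s ∈ Icc (0 : ℝ) 1, IsFiberKernel (volume.restrict Ω) (ballMeasure N)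
      (volume.restrict Ω) (gradWeight ρ η s) (stepMap η s) b' C') :
    ∃ A : Icc (0 : ℝ) 1 → W11 Ω →L[ℝ] W11 Ω,
      (∀ (s : Icc (0 : ℝ) 1) (u : W11 Ω) (f : EucSp N → ℝ), IsRepr f u →
        IsRepr (fiberAverage (ballMeasure N) (mollWeight ℝ ρ) (stepMap η s) f) (A s u)) ∧
      ∀ (s : ℕ → Icc (0 : ℝ) 1), Tendsto (fun n => (s n : ℝ)) atTop (𝓝 0) →
        ∀ u : W11 Ω, Tendsto (fun n => A (s n) u) atTop (𝓝 u) := by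
  have hT : ∀ s : Icc (0 : ℝ) 1, ∀ f g, HasWeakGradient Ω f g →
      HasWeakGradient Ω ((hk s s.2).toCLM f) ((hk' s s.2).toCLM g) := fun s f g hfg =>
    hasWeakGradient_of_ae_eq ((hk s s.2).coeFn_toCLM f) ((hk' s s.2).coeFn_toCLM g)
      fun φ hφ v => hη.weak_gradient_fiberAverage hηs hρ hL s.2 (Lp_one_integrable f)
        (Lp_one_integrable g) hfg hφ v
  have h0 : (0 : ℝ) ∈ Icc (0 : ℝ) 1 := left_mem_Icc.2 zero_le_one
  refine ⟨fun s => W11.mapCLM _ _ (hT s), fun s u f hf => ?_, fun s hs u => ?_⟩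
  · have h1 := (hk s s.2).fiberAverage_congr hf
    have h2 := (hk s s.2).coeFn_toCLM u.1.fst
    rw [IsRepr, W11.mapCLM_fst]
    exact h1.trans h2.symm
  · refine W11.tendsto_of_tendsto ?_ ?_
    · simp only [W11.mapCLM_fst]
      refine tendsto_Lp_of_ae_eq (fun n => (hk (s n) (s n).2).coeFn_toCLM u.1.fst) ?_
      have h := hη.tendsto_fiberAverage_mollWeight hk (fun n => (s n).2) h0 hs
        (Lp_one_integrable u.1.fst)
      rwa [hρ.fiberAverage_stepMap_zero] at h
    · simp only [W11.mapCLM_snd]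
      refine tendsto_Lp_of_ae_eq (fun n => (hk' (s n) (s n).2).coeFn_toCLM u.1.snd) ?_
      have h := hη.tendsto_fiberAverage_gradWeight hρ hL hk' (fun n => (s n).2) h0 hs
        (Lp_one_integrable u.1.snd)
      rwa [fiberAverage_gradWeight_stepMap_zero hρ] at h

end IsQuadraticStep

end Operator

/-! ### Steps of the form `c (T_θ σ)²` have bounded gradient. -/

section WhitneyStep

variable {N : ℕ} {Ω : Set (EucSp N)} {ρ η θ : EucSp N → ℝ}

theorem exists_lipschitz_of_contDiff {S : Set (EucSp N)} (hS : Bornology.IsBounded S)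
    (hθ : ContDiff ℝ 1 θ) : ∃ K : ℝ, 0 ≤ K ∧ ∀ x ∈ S, ∀ y ∈ S, |θ x - θ y| ≤ K * ‖x - y‖ := by
  -- The mean value inequality needs a convex set, so it is applied on an enclosing ball.
  obtain ⟨R, hR⟩ := hS.subset_closedBall 0
  obtain ⟨K, hK⟩ := (isCompact_closedBall (0 : EucSp N) R).exists_bound_of_continuousOn
    (hθ.continuous_fderiv one_ne_zero).continuousOn
  refine ⟨max K 0, le_max_right _ _, fun x hx y hy => ?_⟩
  exact (convex_closedBall (0 : EucSp N) R).norm_image_sub_le_of_norm_fderiv_le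
    (fun z _ => (hθ.differentiable one_ne_zero) z) (fun z hz => (hK z hz).trans (le_max_left _ _))
    (hR hy) (hR hx)

/-- As `σ` is 1-Lipschitz on the whole space, for each `z` in the unit ball the integrands differ by
at most `ρ(z) |(x - y) - (θ(x) - θ(y)) z|`. -/
theorem abs_varMollify_bdryDist_sub_le (hρ : IsMollifierKernel ρ) (θ : EucSp N → ℝ)
    (x y : EucSp N) :
    |varMollify ρ θ (bdryDist Ω) x - varMollify ρ θ (bdryDist Ω) y|
      ≤ ‖x - y‖ + |θ x - θ y| := by
  have hM := hρ.mollConst_pos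
  have hρc := hρ.smooth.continuous
  have hσc : Continuous (bdryDist Ω) := (lipschitzWith_bdryDist Ω).continuous
  have hi : ∀ x, Integrable (fun z => ρ z * bdryDist Ω (x - θ x • z)) (ballMeasure N) := fun x =>
    integrable_of_continuous_of_isBounded Metric.isBounded_ball (by fun_prop)
  have hρi : Integrable ρ (ballMeasure N) :=
    integrable_of_continuous_of_isBounded Metric.isBounded_ball hρc
  rw [varMollify, varMollify, ← mul_sub, ← integral_sub (hi x) (hi y), abs_mul,
    abs_of_pos (inv_pos.2 hρ.integral_pos)]
  have hbound : ‖∫ z in Metric.ball (0 : EucSp N) 1, (ρ z * bdryDist Ω (x - θ x • z)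
      - ρ z * bdryDist Ω (y - θ y • z))‖
      ≤ ∫ z in Metric.ball (0 : EucSp N) 1, ρ z * (‖x - y‖ + |θ x - θ y|) := by
    refine norm_integral_le_of_norm_le (hρi.mul_const _) ?_
    filter_upwards [ae_restrict_mem Metric.isOpen_ball.measurableSet] with z hz
    rw [← mul_sub, norm_mul, Real.norm_eq_abs (ρ z), abs_of_nonneg (hρ.nonneg z)]
    refine mul_le_mul_of_nonneg_left ?_ (hρ.nonneg z)
    refine ((lipschitzWith_bdryDist Ω).norm_sub_le _ _).trans ?_
    rw [NNReal.coe_one, one_mul]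
    have h1 : x - θ x • z - (y - θ y • z) = (x - y) - (θ x - θ y) • z := by module
    rw [h1]
    refine (norm_sub_le _ _).trans ?_
    rw [norm_smul, Real.norm_eq_abs]
    gcongr
    exact mul_le_of_le_one_right (abs_nonneg _) (mem_ball_zero_iff.1 hz).le
  rw [integral_mul_const] at hbound
  rw [inv_mul_le_iff₀ hρ.integral_pos]
  exact hbound

theorem boundedGradientOn_of_eq_sq_varMollify (hΩo : IsOpen Ω) (hΩb : Bornology.IsBounded Ω)
    (hρ : IsMollifierKernel ρ) (hθ : ContDiff ℝ 1 θ) {c : ℝ}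
    (hη : ∀ x ∈ Ω, η x = c * varMollify ρ θ (bdryDist Ω) x ^ 2) : BoundedGradientOn Ω η := by
  rcases Ω.eq_empty_or_nonempty with rfl | ⟨x₀, hx₀⟩
  · exact ⟨0, by simp⟩
  obtain ⟨K, hK0, hK⟩ := exists_lipschitz_of_contDiff hΩb hθ
  obtain ⟨R, hR⟩ := hΩb.subset_closedBall x₀
  set τ := varMollify ρ θ (bdryDist Ω) with hτ
  have hlip : ∀ x ∈ Ω, ∀ y ∈ Ω, |τ x - τ y| ≤ (1 + K) * ‖x - y‖ := fun x hx y hy => by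
    have h1 := abs_varMollify_bdryDist_sub_le (Ω := Ω) hρ θ x y
    have h2 := hK x hx y hy
    linarith
  have hR0 : 0 ≤ R := by simpa using hR hx₀
  set S := |τ x₀| + (1 + K) * R with hS
  have hSb : ∀ x ∈ Ω, |τ x| ≤ S := fun x hx => by
    have h1 := hlip x hx x₀ hx₀
    have h2 : ‖x - x₀‖ ≤ R := mem_closedBall_iff_norm.1 (hR hx)
    have h3 := abs_sub_abs_le_abs_sub (τ x) (τ x₀)
    have h4 : (1 + K) * ‖x - x₀‖ ≤ (1 + K) * R := by gcongr
    linarith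
  have hS0 : 0 ≤ S := by positivity
  refine ⟨|c| * ((2 * S) * (1 + K)), fun x hx => ?_⟩
  -- A local Lipschitz bound at `x` bounds the derivative; it comes from factoring the difference of
  -- squares `τ y ^ 2 - τ x ^ 2`.
  refine norm_fderiv_le_of_lip' ℝ (by positivity) ?_
  filter_upwards [hΩo.mem_nhds hx] with y hy
  have h1 : η y - η x = c * ((τ y + τ x) * (τ y - τ x)) := by
    rw [hη y hy, hη x hx]; ring
  have h2 : |τ y + τ x| ≤ 2 * S := by
    have := abs_add_le (τ y) (τ x)
    linarith [hSb x hx, hSb y hy]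
  have h3 := mul_le_mul h2 (hlip y hy x hx) (abs_nonneg _) (by positivity)
  rw [h1, Real.norm_eq_abs, abs_mul, abs_mul]
  calc |c| * (|τ y + τ x| * |τ y - τ x|) ≤ |c| * (2 * S * ((1 + K) * ‖y - x‖)) := by gcongr
    _ = |c| * (2 * S * (1 + K)) * ‖y - x‖ := by ring

end WhitneyStep

set_option maxHeartbeats 1000000 in
theorem proposition5p5 (N : ℕ) (hN : 0 < N) (Ω : Set (EucSp N)) (hΩo : IsOpen Ω)
    (hΩb : Bornology.IsBounded Ω) (ρ : EucSp N → ℝ) (hρ : IsMollifierKernel ρ)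
    (η : EucSp N → ℝ) (hηs : ContDiffOn ℝ ∞ η Ω) (hηd : ∀ x ∈ Ω, η x ≤ bdryDist Ω x)
    (hηq : QuadraticStep Ω η) :
    -- `T_n f → f` in `L¹(Ω)`
    (∀ f : EucSp N → ℝ, MemLp f 1 (volume.restrict Ω) →
      (∀ n : ℕ, 1 ≤ n → MemLp (varMollifySeq ρ η n f) 1 (volume.restrict Ω)) ∧
      Tendsto (fun n : ℕ => eLpNorm (varMollifySeq ρ η n f - f) 1 (volume.restrict Ω))
        atTop (𝓝 0)) ∧
    (BoundedGradientOn Ω η →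
      -- `T` is a bounded linear operator on `W^{1,1}(Ω)`
      (∃ A : W11 Ω →L[ℝ] W11 Ω, ∀ (u : W11 Ω) (f : EucSp N → ℝ), IsRepr f u →
        IsRepr (varMollify ρ η f) (A u)) ∧
      -- `T_n u → u` in `W^{1,1}(Ω)`
      (∀ (u : W11 Ω) (f : EucSp N → ℝ), IsRepr f u →
        ∃ w : ℕ → W11 Ω, (∀ n : ℕ, 1 ≤ n → IsRepr (varMollifySeq ρ η n f) (w n)) ∧
          Tendsto w atTop (𝓝 u))) ∧
    -- a step function `η = c (T₀ σ)²`, with `T₀` built from a Whitney function of `∂Ω`,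
    -- has a bounded gradient
    (∀ (θ : EucSp N → ℝ) (c : ℝ), IsWhitneyFunction (frontier Ω) θ →
      (∀ x ∈ Ω, η x = c * varMollify ρ θ (bdryDist Ω) x ^ 2) → BoundedGradientOn Ω η) := by
  obtain ⟨κ, hκ, hq⟩ := hηq
  have hη : IsQuadraticStep Ω η κ :=
    ⟨hκ, hN, hΩo, hΩb, fun x hx => (hq x hx).1, fun x hx => (hq x hx).2, hηd⟩
  refine ⟨fun f hf => ⟨fun n _ => hη.memLp_varMollifySeq hηs hρ hf n,
    hη.tendsto_varMollifySeq hηs hρ hf⟩, fun hb => ?_, fun θ c hθ hc =>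
    boundedGradientOn_of_eq_sq_varMollify hΩo hΩb hρ (hθ.smooth.of_le (by simp)) hc⟩
  obtain ⟨L, hL⟩ := hb
  have hL' : ∀ x ∈ Ω, ‖gradient η x‖ ≤ L := fun x hx => by
    rw [norm_gradient]
    exact hL x hx
  obtain ⟨b, C, hk⟩ := hη.exists_isFiberKernel_mollWeight hηs hρ ℝ
  obtain ⟨b', C', hk'⟩ := hη.exists_isFiberKernel_gradWeight hηs hρ hL'
  obtain ⟨A, hA, hlim⟩ := hη.exists_W11_operators hηs hρ hL' hk hk'
  -- Both claims use the same family: `s = 1` gives `T` and `s = n⁻¹` gives `T_n`.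
  refine ⟨⟨A ⟨1, right_mem_Icc.2 zero_le_one⟩, fun u f hf => ?_⟩, fun u f hf =>
    ⟨fun n => A ⟨(n : ℝ)⁻¹, inv_natCast_mem_Icc n⟩ u, fun n _ => ?_, ?_⟩⟩
  · have h := hA ⟨1, right_mem_Icc.2 zero_le_one⟩ u f hf
    rw [← varMollify_eq_fiberAverage] at h
    simpa only [one_mul] using h
  · rw [varMollifySeq_eq_fiberAverage]
    exact hA ⟨(n : ℝ)⁻¹, inv_natCast_mem_Icc n⟩ u f hf
  · exact hlim (fun n => ⟨(n : ℝ)⁻¹, inv_natCast_mem_Icc n⟩) tendsto_inv_atTop_nhds_zero_nat u
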